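/- Let $\mathcal X,\mathcal Y$ be measurable spaces, $\mathcal Z=\mathcal X\times\mathcal Y$, and let $k_{\mathcal X}$, $k_{\mathcal Y}$ be jointly measurable, symmetric, positive (semi)definite real kernels on $\mathcal X$ and $\mathcal Y$. For a probability measure $P$ on $\mathcal Z$ put, with $(X,Y),(X',Y')$ independent of law $P$, $$\mathrm{HSIC}(P)=E\big[k_{\mathcal X}(X,X')k_{\mathcal Y}(Y,Y')\big]+E\big[k_{\mathcal X}(X,X')\big]E\big[k_{\mathcal Y}(Y,Y')\big]-2E_{XY}\big[E_{X'}k_{\mathcal X}(X,X')\,E_{Y'}k_{\mathcal Y}(Y,Y')\big],$$ and for points $z_i=(x_i,y_i)$, $i=1,\dots,n$, let $$\mathrm{HSIC}_{obs}(z_1,\dots,z_n)=\frac1{n^2}\sum_{i,j}k_{\mathcal X}(x_i,x_j)k_{\mathcal Y}(y_i,y_j)+\frac1{n^4}\sum_{i,j,q,r}k_{\mathcal X}(x_i,x_j)k_{\mathcal Y}(y_q,y_r)-\frac2{n^3}\sum_{i,j,q}k_{\mathcal X}(x_i,x_j)k_{\mathcal Y}(y_i,y_q)$$ be the classical empirical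 (V-statistic) estimate. Let $Z_i=(X_i,Y_i)$, $i\ge1$, be i.i.d. with law $P_{XY}$ on $\mathcal Z$, where $\sqrt{k_{\mathcal X}(x,x)}$, $\sqrt{k_{\mathcal Y}(y,y)}$ and $\sqrt{k_{\mathcal X}(x,x)k_{\mathcal Y}(y,y)}$ are $P_{XY}$-integrable. Let $s>0$ and let $\nu^*$ be a probability measure on $\mathcal Z$ for which $k_{\mathcal X}(x,x)$, $k_{\mathcal Y}(y,y)$ and $k_{\mathcal X}(x,x)k_{\mathcal Y}(y,y)$ are integrable. (All these conditions hold for bounded kernels.) Let $Dp(s,\nu^*)$ be the Dirichlet process with base measure $s\nu^*$, i.e. the law of a random probability measure $P_0$ on $\mathcal Z$ such that $(P_0(B_1),\dots,P_0(B_m))\sim \mathrm{Dir}(s\nu^*(B_1),\dots,s\nu^*(B_m))$ for every finite measurable partition $B_1,\dots,B_m$ of $\mathcal Z$. Given $Z_1,\dots,Z_n$, the posterior is the law of the random measure $$P=w_0P_0+\sum_{i=1}^n w_i\delta_{Z_i},\qquad (w_0,\dots,w_n)\sim \mathrm{Dir}(s,1,\dots,1)\ \text{ independent of }\ P_0\sim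 Dp(s,\nu^*),$$ and the Bayesian estimate is the random variable $\widehat{\mathrm{HSIC}}_n=\mathrm{HSIC}(P)$ under this posterior. The limiting case $s=0$ is included: there $w_0=0$ and $(w_1,\dots,w_n)\sim\mathrm{Dir}(1,\dots,1)$, and no prior component is present. Then, for almost every sequence $(Z_i)_{i\ge1}$: 1. the posterior mean $\mathcal E[\widehat{\mathrm{HSIC}}_n]$ exists (the variable is integrable under the posterior) for every $n$; 2. $\mathrm{HSIC}_{obs}(Z_1,\dots,Z_n)\to \mathrm{HSIC}(P_{XY})$ as $n\to\infty$; 3. $\mathcal E[\widehat{\mathrm{HSIC}}_n]\to\mathrm{HSIC}(P_{XY})$ as $n\to\infty$, i.e. the posterior mean has the same limit as the empirical estimate; 4. (asymptotic consistency) for every $\varepsilon>0$ the posterior probability of $|\widehat{\mathrm{HSIC}}_n-\mathrm{HSIC}(P_{XY})|\ge\varepsilon$ tends to $0$ as $n\to\infty$. -/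

import Mathlib

open MeasureTheory ProbabilityTheory Filter
open scoped Topology

noncomputable section

namespace BayesHSIC

/-- A measurable (real-valued, symmetric, positive definite) kernel: all Gram matrices of `k` are
symmetric and positive semidefinite, and `k` is jointly measurable. -/
structure IsMeasurableKernel {S : Type*} [MeasurableSpace S] (k : S → S → ℝ) : Prop where
  posSemidef : (Matrix.of k).PosSemidef
  measurable : Measurable (Function.uncurry k)

/-- The Gamma distribution with shape `a` and rate `1`; for `a = 0` it is the point mass at `0`. -/
def gammaLaw (a : ℝ) : Measure ℝ :=
  if a = 0 then Measure.dirac 0 else gammaMeasure a 1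

/-- The Dirichlet distribution with parameters `α i ≥ 0`, not all zero: the law of
`(G i / ∑ j, G j)` for independent `G i ∼ Gamma (α i, 1)`. Coordinates with `α i = 0` vanish. -/
def dirichletLaw {ι : Type*} [Fintype ι] (α : ι → ℝ) : Measure (ι → ℝ) :=
  (Measure.pi fun i => gammaLaw (α i)).map fun g i => g i / ∑ j, g j

/-- `Q`, a probability law on the probability measures on `S`, is the Dirichlet process with base
measure `ν`: for every finite measurable partition `B 0, …, B (m - 1)` of `S`, the vector of the
`P (B i)` with `P ∼ Q` is Dirichlet distributed with parameters `ν (B i)`. -/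
structure IsDirichletProcess {S : Type*} [MeasurableSpace S] (ν : Measure S)
    (Q : Measure (Measure S)) : Prop where
  isProbabilityMeasure : IsProbabilityMeasure Q
  ae_isProbabilityMeasure : ∀ᵐ P ∂Q, IsProbabilityMeasure P
  map_partition : ∀ (m : ℕ) (B : Fin m → Set S), (∀ i, MeasurableSet (B i)) →
    Pairwise (Function.onFun Disjoint B) → ⋃ i, B i = Set.univ →
    Q.map (fun P i => (P (B i)).toReal) = dirichletLaw fun i => (ν (B i)).toReal

/-- The random measure `w 0 • P₀ + ∑ i, w (i + 1) • δ_{z i}`. -/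
def mixture {S : Type*} [MeasurableSpace S] {n : ℕ} (z : Fin n → S) (w : Fin (n + 1) → ℝ)
    (P₀ : Measure S) : Measure S :=
  ENNReal.ofReal (w 0) • P₀ + ∑ i : Fin n, ENNReal.ofReal (w i.succ) • Measure.dirac (z i)

/-- The posterior law given the observations `z 0, …, z (n - 1)`: the law of
`w 0 • P₀ + ∑ i, w (i + 1) • δ_{z i}`, where `w ∼ Dir (s, 1, …, 1)` and `P₀ ∼ Q` are
independent. For `s = 0` one has `w 0 = 0` almost surely, so that `Q` plays no role. -/
def posterior {S : Type*} [MeasurableSpace S] (s : ℝ) (Q : Measure (Measure S)) {n : ℕ}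
    (z : Fin n → S) : Measure (Measure S) :=
  ((dirichletLaw (Fin.cons s (fun _ => 1) : Fin (n + 1) → ℝ)).prod Q).map
    fun p => mixture z p.1 p.2

section HSIC

variable {𝒳 𝒴 : Type*} [MeasurableSpace 𝒳] [MeasurableSpace 𝒴]

/-- The Hilbert-Schmidt independence criterion of `(X, Y) ∼ P`. -/
def hsic (kX : 𝒳 → 𝒳 → ℝ) (kY : 𝒴 → 𝒴 → ℝ) (P : Measure (𝒳 × 𝒴)) : ℝ :=
  (∫ p, kX p.1.1 p.2.1 * kY p.1.2 p.2.2 ∂(P.prod P))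
    + (∫ p, kX p.1.1 p.2.1 ∂(P.prod P)) * (∫ p, kY p.1.2 p.2.2 ∂(P.prod P))
    - 2 * ∫ z, (∫ z', kX z.1 z'.1 ∂P) * (∫ z', kY z.2 z'.2 ∂P) ∂P

/-- The classical empirical (V-statistic) estimate of the criterion. -/
def hsicObs (kX : 𝒳 → 𝒳 → ℝ) (kY : 𝒴 → 𝒴 → ℝ) {n : ℕ} (z : Fin n → 𝒳 × 𝒴) : ℝ :=
  1 / (n : ℝ) ^ 2 * ∑ i, ∑ j, kX (z i).1 (z j).1 * kY (z i).2 (z j).2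
    + 1 / (n : ℝ) ^ 4 * ∑ i, ∑ j, ∑ q, ∑ r, kX (z i).1 (z j).1 * kY (z q).2 (z r).2
    - 2 / (n : ℝ) ^ 3 * ∑ i, ∑ j, ∑ q, kX (z i).1 (z j).1 * kY (z i).2 (z q).2

end HSIC

end BayesHSIC

end

noncomputable section

namespace BayesHSIC

open scoped TensorProduct

universe u

/-! Represent the kernels by feature maps `φ`, `ψ` into Hilbert spaces. If `a`, `b`, `u` are the
means under a finite measure of `φ`, `ψ` and of their tensor product, then expanding the square
gives HSIC = ‖u - a ⊗ b‖² (`hsic_eq_norm_sq`). The empirical estimate is the same expression with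
sample averages (`hsicObs_eq_norm_sq`), and the criterion of a posterior draw is the same expression
with Dirichlet-weighted sums. So everything reduces to convergence of averages and weighted sums in
Hilbert space norm.

The Hilbert spaces need not be separable and the features need not be strongly measurable. Means are
therefore weak (Riesz), and the law of large numbers `ae_tendsto_norm_average` uses only joint
measurability of the kernel: centred bounded summands are orthogonal in L², which gives convergence
along squares; truncation does the rest.

For the posterior, recentre at `a`, `b`, `u`. The expectation of ‖∑ w_i ξ_i‖² under Dirichlet
weights is explicit. It tends to 0 because ∑ ξ_i = o(n) in norm and ∑ ‖ξ_i‖² = o(n²), the latter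
following from uniform integrability although only first moments of the sample are available. The
perturbation of a ⊗ b also produces a product of two squared deviations. It is handled by truncating
one factor and bounding degree-four Dirichlet moments by a constant times n⁻⁴.

All these bounds are uniform in the prior draw P₀ up to a factor built from squared norms of its
means. That factor is integrable by the second moment inequality for the Dirichlet process
(`IsDirichletProcess.secondMomentBound`), and this is where the three moment conditions on ν enter.
The outcome is L¹ convergence of the criterion under the posterior
(`IsFeaturePair.tendsto_lintegral_posterior`), which gives both the limit of the mean and, by
Markov, consistency. -/

/-- The pointwise tensor product of two maps, in the completed tensor product. -/
def tensorFeature {S H H' : Type*} [NormedAddCommGroup H] [InnerProductSpace ℝ H]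
    [NormedAddCommGroup H'] [InnerProductSpace ℝ H'] (φ : S → H) (ψ : S → H') (z : S) :
    UniformSpace.Completion (H ⊗[ℝ] H') :=
  ((φ z ⊗ₜ[ℝ] ψ z : H ⊗[ℝ] H') : UniformSpace.Completion (H ⊗[ℝ] H'))

theorem norm_tensorFeature {S H H' : Type*} [NormedAddCommGroup H] [InnerProductSpace ℝ H]
    [NormedAddCommGroup H'] [InnerProductSpace ℝ H'] (φ : S → H) (ψ : S → H') (z : S) :
    ‖tensorFeature φ ψ z‖ = ‖φ z‖ * ‖ψ z‖ := by
  simp [tensorFeature]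

theorem inner_tensorFeature {S H H' : Type*} [NormedAddCommGroup H] [InnerProductSpace ℝ H]
    [NormedAddCommGroup H'] [InnerProductSpace ℝ H'] (φ : S → H) (ψ : S → H') (z : S) (a : H)
    (b : H') :
    inner ℝ (tensorFeature φ ψ z) ((a ⊗ₜ[ℝ] b : H ⊗[ℝ] H') : UniformSpace.Completion (H ⊗[ℝ] H'))
      = inner ℝ (φ z) a * inner ℝ (ψ z) b := by
  simp [tensorFeature]

/-! ### Feature maps and weak means in Hilbert space -/

section Feature

variable {S H H' : Type*} [MeasurableSpace S]
  [NormedAddCommGroup H] [InnerProductSpace ℝ H] [NormedAddCommGroup H'] [InnerProductSpace ℝ H']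

/-- A weakly measurable Hilbert space valued map whose kernel is jointly measurable. -/
structure IsFeature (φ : S → H) : Prop where
  measurable_inner : ∀ f, Measurable fun z => inner ℝ (φ z) f
  measurable_kernel : Measurable fun p : S × S => inner ℝ (φ p.1) (φ p.2)

/-- The norm is the root of the kernel on the diagonal; without separability, weak measurability
alone would not suffice. -/
theorem IsFeature.measurable_norm {φ : S → H} (h : IsFeature φ) :
    Measurable fun z => ‖φ z‖ := by
  have : (fun z => ‖φ z‖) = fun z => √(inner ℝ (φ z) (φ z)) := by
    funext z
    rw [real_inner_self_eq_norm_sq, Real.sqrt_sq (norm_nonneg _)]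
  rw [this]
  exact (h.measurable_kernel.comp (measurable_id.prodMk measurable_id)).sqrt

theorem IsFeature.comp {T : Type*} [MeasurableSpace T] {φ : S → H} (h : IsFeature φ) {g : T → S}
    (hg : Measurable g) : IsFeature (φ ∘ g) where
  measurable_inner f := (h.measurable_inner f).comp hg
  measurable_kernel :=
    h.measurable_kernel.comp ((hg.comp measurable_fst).prodMk (hg.comp measurable_snd))

/-- `m` is the weak (Pettis) mean of `φ` with respect to `M`. -/
structure HasMean (φ : S → H) (M : Measure S) (m : H) : Prop where
  integrable : ∀ f, Integrable (fun z => inner ℝ (φ z) f) M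
  integral_eq : ∀ f, ∫ z, inner ℝ (φ z) f ∂M = inner ℝ m f

theorem IsFeature.integrable_inner {φ : S → H} (h : IsFeature φ) {M : Measure S}
    (hM : Integrable (fun z => ‖φ z‖) M) (f : H) : Integrable (fun z => inner ℝ (φ z) f) M := by
  refine (hM.mul_const ‖f‖).mono' (h.measurable_inner f).aestronglyMeasurable ?_
  exact ae_of_all _ fun z => norm_inner_le_norm _ _

/-- Riesz representation of f ↦ ∫ ⟪φ, f⟫. A Bochner integral is not available, since `φ` may fail to
be strongly measurable. -/
theorem IsFeature.exists_hasMean [CompleteSpace H] {φ : S → H} (h : IsFeature φ) {M : Measure S}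
    (hM : Integrable (fun z => ‖φ z‖) M) : ∃ m, HasMean φ M m := by
  let ℓ : H →ₗ[ℝ] ℝ :=
    { toFun := fun f => ∫ z, inner ℝ (φ z) f ∂M
      map_add' := fun f g => by
        simp_rw [inner_add_right]
        exact integral_add (h.integrable_inner hM f) (h.integrable_inner hM g)
      map_smul' := fun c f => by
        simp_rw [real_inner_smul_right, integral_const_mul]
        rfl }
  let L : StrongDual ℝ H := ℓ.mkContinuous (∫ z, ‖φ z‖ ∂M) fun f => by
    refine (norm_integral_le_integral_norm _).trans ?_
    rw [← integral_mul_const]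
    exact integral_mono (h.integrable_inner hM f).norm (hM.mul_const _)
      fun z => norm_inner_le_norm _ _
  refine ⟨(InnerProductSpace.toDual ℝ H).symm L, h.integrable_inner hM, fun f => ?_⟩
  rw [InnerProductSpace.toDual_symm_apply]
  rfl

theorem HasMean.norm_le {φ : S → H} {M : Measure S} {m : H} (h : HasMean φ M m)
    (hM : Integrable (fun z => ‖φ z‖) M) : ‖m‖ ≤ ∫ z, ‖φ z‖ ∂M := by
  rcases eq_or_ne m 0 with rfl | hm
  · simpa using integral_nonneg fun z => norm_nonneg (φ z)
  -- Test the mean against itself and cancel one factor ‖m‖.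
  refine le_of_mul_le_mul_right ?_ (norm_pos_iff.2 hm)
  rw [← real_inner_self_eq_norm_mul_norm, ← h.integral_eq, ← integral_mul_const]
  exact integral_mono (h.integrable m) (hM.mul_const _) fun z => real_inner_le_norm _ _

theorem HasMean.sub {φ ψ : S → H} {M : Measure S} {m m' : H} (h : HasMean φ M m)
    (h' : HasMean ψ M m') : HasMean (fun z => φ z - ψ z) M (m - m') where
  integrable f := by
    simp_rw [inner_sub_left]
    exact (h.integrable f).sub (h'.integrable f)
  integral_eq f := by
    simp_rw [inner_sub_left]
    rw [integral_sub (h.integrable f) (h'.integrable f), h.integral_eq, h'.integral_eq]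

theorem HasMean.add_measure {φ : S → H} {M N : Measure S} {m m' : H} (h : HasMean φ M m)
    (h' : HasMean φ N m') : HasMean φ (M + N) (m + m') where
  integrable f := (h.integrable f).add_measure (h'.integrable f)
  integral_eq f := by
    rw [integral_add_measure (h.integrable f) (h'.integrable f), h.integral_eq, h'.integral_eq,
      inner_add_left]

theorem HasMean.smul_measure {φ : S → H} {M : Measure S} {m : H} (h : HasMean φ M m) {c : ℝ}
    (hc : 0 ≤ c) : HasMean φ (ENNReal.ofReal c • M) (c • m) where
  integrable f := (h.integrable f).smul_measure ENNReal.ofReal_ne_top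
  integral_eq f := by
    rw [integral_smul_measure, h.integral_eq, ENNReal.toReal_ofReal hc, real_inner_smul_left,
      smul_eq_mul]

theorem IsFeature.hasMean_dirac {φ : S → H} (h : IsFeature φ) (z : S) :
    HasMean φ (Measure.dirac z) (φ z) where
  integrable f := integrable_dirac' (h.measurable_inner f).stronglyMeasurable (by simp)
  integral_eq f := integral_dirac' _ _ (h.measurable_inner f).stronglyMeasurable

theorem hasMean_zero_measure (φ : S → H) : HasMean φ 0 0 where
  integrable f := integrable_zero_measure
  integral_eq f := by simp

theorem HasMean.sum_measure {ι : Type*} {φ : S → H} {M : ι → Measure S} {m : ι → H}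
    (h : ∀ i, HasMean φ (M i) (m i)) (s : Finset ι) :
    HasMean φ (∑ i ∈ s, M i) (∑ i ∈ s, m i) := by
  classical
  induction s using Finset.induction_on with
  | empty => simpa using hasMean_zero_measure φ
  | insert i s hi ih =>
    rw [Finset.sum_insert hi, Finset.sum_insert hi]
    exact (h i).add_measure ih

theorem IsFeature.hasMean_mixture {φ : S → H} (h : IsFeature φ) {n : ℕ} (z : Fin n → S)
    {w : Fin (n + 1) → ℝ} (hw : ∀ i, 0 ≤ w i) {P₀ : Measure S} {m : H} (hm : HasMean φ P₀ m) :
    HasMean φ (mixture z w P₀) (w 0 • m + ∑ i : Fin n, w i.succ • φ (z i)) :=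
  (hm.smul_measure (hw 0)).add_measure
    (HasMean.sum_measure (fun i => (h.hasMean_dirac (z i)).smul_measure (hw _)) _)

/-- The canonical feature of the RKHS works: pairing with a kernel section is a section of `k`,
hence measurable; this passes to the span and, by pointwise limits, to its closure, the whole space.
-/
theorem IsMeasurableKernel.exists_feature {S : Type u} [MeasurableSpace S] {k : S → S → ℝ}
    (hk : IsMeasurableKernel k) :
    ∃ (H : Type u) (_ : NormedAddCommGroup H) (_ : InnerProductSpace ℝ H) (_ : CompleteSpace H)
      (φ : S → H), IsFeature φ ∧ ∀ x y, inner ℝ (φ x) (φ y) = k x y := by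
  have hsymm : ∀ x y, k y x = k x y := fun x y => by
    simpa using hk.posSemidef.isHermitian.apply x y
  -- The RKHS construction takes operator-valued kernels, so `k` acts as multiples of the identity
  -- of ℝ.
  let K : Matrix S S (ℝ →L[ℝ] ℝ) := .of fun x y => k x y • (1 : ℝ →L[ℝ] ℝ)
  have hK : K.PosSemidef := by
    refine ((RKHS.posSemidef_tfae (K := K)).out 0 2).2 (And.intro ?_ fun vv => ?_)
    · ext x y
      simp [K, Matrix.conjTranspose_apply, hsymm]
    · have := hk.posSemidef.2 vv
      refine this.trans_eq ?_
      simp only [K, Matrix.of_apply, star_trivial, RCLike.re_to_real]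
      refine Finsupp.sum_congr fun x _ => Finsupp.sum_congr fun y _ => ?_
      simp [hsymm x y]
      ring
  have : Fact K.PosSemidef := ⟨hK⟩
  let φ : S → RKHS.OfKernel K := fun x => RKHS.kerFun (RKHS.OfKernel K) x (1 : ℝ)
  have hφ : ∀ x y, inner ℝ (φ x) (φ y) = k x y := fun x y => by
    simp [φ, RKHS.kerFun_apply, K, hsymm x y]
  refine ⟨RKHS.OfKernel K, inferInstance, inferInstance, inferInstance, φ, ⟨fun f => ?_, ?_⟩, hφ⟩
  · have hmem : f ∈ (Submodule.span ℝ {x | ∃ y v, RKHS.kerFun (RKHS.OfKernel K) y v = x}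
        ).topologicalClosure := by
      rw [RKHS.kerFun_dense]; trivial
    rw [← SetLike.mem_coe, Submodule.topologicalClosure_coe] at hmem
    obtain ⟨u, hu, hlim⟩ := mem_closure_iff_seq_limit.1 hmem
    refine measurable_of_tendsto_metrizable (f := fun n z => inner ℝ (φ z) (u n)) (fun n => ?_)
      (tendsto_pi_nhds.2 fun z => tendsto_const_nhds.inner hlim)
    refine Submodule.span_induction (p := fun g _ => Measurable fun z => inner ℝ (φ z) g)
      ?_ ?_ ?_ ?_ (hu n)
    · rintro _ ⟨y, v, rfl⟩
      have : RKHS.kerFun (RKHS.OfKernel K) y v = v • φ y := by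
        simp only [φ, ← map_smul, smul_eq_mul, mul_one]
      simp_rw [this, real_inner_smul_right, hφ]
      exact (hk.measurable.comp (measurable_id.prodMk measurable_const)).const_mul v
    · simp
    · intro g g' _ _ h h'
      simp_rw [inner_add_right]
      exact h.add h'
    · intro c g _ h
      simp_rw [real_inner_smul_right]
      exact h.const_mul c
  · simp_rw [hφ]
    exact hk.measurable

/-- Pairing with a pure tensor factorizes; sums of pure tensors are dense in the completion, and
measurability survives limits. -/
theorem IsFeature.tensor {φ : S → H} {ψ : S → H'} (hφ : IsFeature φ) (hψ : IsFeature ψ) :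
    IsFeature (tensorFeature φ ψ) where
  measurable_inner f := by
    obtain ⟨u, hu, hlim⟩ := mem_closure_iff_seq_limit.1
      ((UniformSpace.Completion.denseRange_coe (α := H ⊗[ℝ] H')).closure_range ▸ Set.mem_univ f)
    refine measurable_of_tendsto_metrizable
      (f := fun n z => inner ℝ (tensorFeature φ ψ z) (u n)) (fun n => ?_)
      (tendsto_pi_nhds.2 fun z => tendsto_const_nhds.inner hlim)
    obtain ⟨t, ht⟩ := hu n
    rw [← ht]
    clear ht
    induction t using TensorProduct.induction_on with
    | zero =>
      have : ((0 : H ⊗[ℝ] H') : UniformSpace.Completion (H ⊗[ℝ] H')) = 0 := rfl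
      simp [this]
    | tmul a b =>
      simp_rw [inner_tensorFeature]
      exact (hφ.measurable_inner a).mul (hψ.measurable_inner b)
    | add a b ha hb =>
      simp_rw [UniformSpace.Completion.coe_add, inner_add_right]
      exact ha.add hb
  measurable_kernel := by
    simp only [tensorFeature, UniformSpace.Completion.inner_coe, TensorProduct.inner_tmul]
    exact hφ.measurable_kernel.mul hψ.measurable_kernel

theorem IsFeature.integrable_kernel {φ : S → H} (h : IsFeature φ) {M : Measure S}
    [IsFiniteMeasure M] (hM : Integrable (fun z => ‖φ z‖) M) :
    Integrable (fun p : S × S => inner ℝ (φ p.1) (φ p.2)) (M.prod M) :=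
  (hM.mul_prod hM).mono' h.measurable_kernel.aestronglyMeasurable
    (ae_of_all _ fun _ => norm_inner_le_norm _ _)

/-- Fubini and the weak definition of the mean, used twice. It serves both the formula for HSIC and
the orthogonality of independent centred summands. -/
theorem HasMean.integral_kernel {φ : S → H} (h : IsFeature φ) {M : Measure S} [IsFiniteMeasure M]
    (hM : Integrable (fun z => ‖φ z‖) M) {m : H} (hm : HasMean φ M m) :
    ∫ p, inner ℝ (φ p.1) (φ p.2) ∂(M.prod M) = ‖m‖ ^ 2 := by
  rw [integral_prod _ (h.integrable_kernel hM), ← real_inner_self_eq_norm_sq, ← hm.integral_eq]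
  congr 1 with z
  simp_rw [fun z' => real_inner_comm (φ z') (φ z)]
  rw [hm.integral_eq, real_inner_comm]

end Feature

/-! ### HSIC as a squared Hilbert space norm -/

section HSIC

variable {𝒳 𝒴 H H' : Type*} [NormedAddCommGroup H] [InnerProductSpace ℝ H]
  [NormedAddCommGroup H'] [InnerProductSpace ℝ H'] {kX : 𝒳 → 𝒳 → ℝ} {kY : 𝒴 → 𝒴 → ℝ}
  {φ : 𝒳 × 𝒴 → H} {ψ : 𝒳 × 𝒴 → H'}

/-- The three terms of HSIC are ‖u‖², ‖a ⊗ b‖² = ‖a‖²‖b‖² and -2⟪u, a ⊗ b⟫, the last being an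
integral of ⟪φ, a⟫⟪ψ, b⟫. -/
theorem hsic_eq_norm_sq [MeasurableSpace 𝒳] [MeasurableSpace 𝒴]
    (hφ : IsFeature φ) (hψ : IsFeature ψ)
    (hkX : ∀ z z', inner ℝ (φ z) (φ z') = kX z.1 z'.1)
    (hkY : ∀ z z', inner ℝ (ψ z) (ψ z') = kY z.2 z'.2)
    {M : Measure (𝒳 × 𝒴)} [IsFiniteMeasure M] (hX : Integrable (fun z => ‖φ z‖) M)
    (hY : Integrable (fun z => ‖ψ z‖) M) (hXY : Integrable (fun z => ‖φ z‖ * ‖ψ z‖) M)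
    {a : H} {b : H'} {u : UniformSpace.Completion (H ⊗[ℝ] H')} (ha : HasMean φ M a)
    (hb : HasMean ψ M b) (hu : HasMean (tensorFeature φ ψ) M u) :
    hsic kX kY M
      = ‖u - ((a ⊗ₜ[ℝ] b : H ⊗[ℝ] H') : UniformSpace.Completion (H ⊗[ℝ] H'))‖ ^ 2 := by
  have e1 := ha.integral_kernel hφ hX
  have e2 := hb.integral_kernel hψ hY
  have e3 := hu.integral_kernel (hφ.tensor hψ) (by simpa only [norm_tensorFeature] using hXY)
  simp only [hkX, hkY, tensorFeature, UniformSpace.Completion.inner_coe,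
    TensorProduct.inner_tmul] at e1 e2 e3
  rw [hsic, e1, e2, e3, norm_sub_sq_real, ← hu.integral_eq]
  simp_rw [inner_tensorFeature]
  have e4 : ∀ z : 𝒳 × 𝒴, ∫ z', kX z.1 z'.1 ∂M = inner ℝ (φ z) a := fun z => by
    rw [real_inner_comm, ← ha.integral_eq]
    simp_rw [fun z' => real_inner_comm (φ z) (φ z'), hkX]
  have e5 : ∀ z : 𝒳 × 𝒴, ∫ z', kY z.2 z'.2 ∂M = inner ℝ (ψ z) b := fun z => by
    rw [real_inner_comm, ← hb.integral_eq]
    simp_rw [fun z' => real_inner_comm (ψ z) (ψ z'), hkY]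
  simp_rw [e4, e5]
  rw [UniformSpace.Completion.norm_coe, TensorProduct.norm_tmul]
  ring

theorem hsicObs_eq_norm_sq (hkX : ∀ z z', inner ℝ (φ z) (φ z') = kX z.1 z'.1)
    (hkY : ∀ z z', inner ℝ (ψ z) (ψ z') = kY z.2 z'.2) {n : ℕ} (z : Fin n → 𝒳 × 𝒴) :
    hsicObs kX kY z
      = ‖(n : ℝ)⁻¹ • ∑ i, tensorFeature φ ψ (z i)
        - ((((n : ℝ)⁻¹ • ∑ i, φ (z i)) ⊗ₜ[ℝ] ((n : ℝ)⁻¹ • ∑ i, ψ (z i)) : H ⊗[ℝ] H') :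
          UniformSpace.Completion (H ⊗[ℝ] H'))‖ ^ 2 := by
  rw [norm_sub_sq_real, UniformSpace.Completion.norm_coe, TensorProduct.norm_tmul, mul_pow]
  simp only [← real_inner_self_eq_norm_sq, real_inner_smul_left, sum_inner, inner_tensorFeature,
    real_inner_smul_right, inner_sum, hkX, hkY]
  simp only [tensorFeature, UniformSpace.Completion.inner_coe, TensorProduct.inner_tmul, hkX, hkY]
  have h4 : ∑ i, ∑ j, ∑ q, ∑ r, kX (z i).1 (z j).1 * kY (z q).2 (z r).2
      = (∑ i, ∑ j, kX (z i).1 (z j).1) * ∑ q, ∑ r, kY (z q).2 (z r).2 := by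
    simp_rw [Finset.sum_mul, Finset.mul_sum]
  have h3 : ∑ i, ((n : ℝ)⁻¹ * ∑ j, kX (z i).1 (z j).1) * ((n : ℝ)⁻¹ * ∑ q, kY (z i).2 (z q).2)
      = (n : ℝ)⁻¹ ^ 2 * ∑ i, ∑ j, ∑ q, kX (z i).1 (z j).1 * kY (z i).2 (z q).2 := by
    rw [Finset.mul_sum]
    refine Finset.sum_congr rfl fun i _ => ?_
    rw [← Finset.sum_mul_sum]
    ring
  have h2 (g : Fin n → Fin n → ℝ) :
      ∑ i, (n : ℝ)⁻¹ * ∑ j, g j i = (n : ℝ)⁻¹ * ∑ i, ∑ j, g i j := by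
    rw [← Finset.mul_sum, Finset.sum_comm]
  rw [hsicObs, h4, h3, h2 fun i j => kX (z i).1 (z j).1 * kY (z i).2 (z j).2,
    h2 fun i j => kX (z i).1 (z j).1, h2 fun i j => kY (z i).2 (z j).2]
  simp only [div_eq_mul_inv, inv_pow]
  ring

end HSIC

/-! ### Moments of the Dirichlet distribution -/

section Dirichlet

theorem ascPochhammer_eval_nonneg {a : ℝ} (ha : 0 ≤ a) (m : ℕ) :
    0 ≤ (ascPochhammer ℝ m).eval a := by
  rcases ha.eq_or_lt with rfl | h
  · rw [ascPochhammer_eval_zero]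
    split_ifs <;> norm_num
  · exact (ascPochhammer_pos _ _ h).le

theorem Gamma_add_nat {a : ℝ} (ha : 0 < a) (m : ℕ) :
    Real.Gamma (a + m) = (ascPochhammer ℝ m).eval a * Real.Gamma a := by
  induction m with
  | zero => simp
  | succ m ih =>
    rw [Nat.cast_succ, ← add_assoc, Real.Gamma_add_one (by positivity), ih,
      ascPochhammer_succ_eval]
    ring

theorem isProbabilityMeasure_gammaLaw {a : ℝ} (ha : 0 ≤ a) :
    IsProbabilityMeasure (gammaLaw a) := by
  unfold gammaLaw
  split_ifs with h
  · infer_instance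
  · exact isProbabilityMeasure_gammaMeasure (lt_of_le_of_ne ha (Ne.symm h)) one_pos

theorem measurable_gammaPDF (a r : ℝ) : Measurable (gammaPDF a r) :=
  (measurable_gammaPDFReal a r).ennreal_ofReal

theorem ae_pos_gammaLaw {a : ℝ} (ha : 0 < a) : ∀ᵐ g ∂gammaLaw a, 0 < g := by
  rw [gammaLaw, if_neg ha.ne', gammaMeasure,
    ae_withDensity_iff (measurable_gammaPDF a 1)]
  filter_upwards [Measure.ae_ne volume (0 : ℝ)] with g hg h
  rcases lt_or_gt_of_ne hg with h' | h'
  · exact absurd (gammaPDF_of_neg h') h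
  · exact h'

theorem ae_nonneg_gammaLaw {a : ℝ} (ha : 0 ≤ a) : ∀ᵐ g ∂gammaLaw a, 0 ≤ g := by
  rcases ha.eq_or_lt with rfl | ha
  · simp [gammaLaw]
  · filter_upwards [ae_pos_gammaLaw ha] with g hg using hg.le

/-- Tilting the Gamma(a, 1) density by g^m exp(-t g) gives a multiple of the Gamma(a + m, 1 + t)
density. For a = 0 the rising factorial vanishes unless m = 0, in accordance with the point mass. -/
theorem lintegral_gammaLaw {a t : ℝ} (ha : 0 ≤ a) (ht : 0 ≤ t) (m : ℕ) :
    ∫⁻ g, ENNReal.ofReal (g ^ m * Real.exp (-(t * g))) ∂gammaLaw a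
      = ENNReal.ofReal ((ascPochhammer ℝ m).eval a * (1 + t) ^ (-(a + m))) := by
  have ht1 : 0 < 1 + t := by linarith
  rcases ha.eq_or_lt with rfl | ha
  · rw [gammaLaw, if_pos rfl, lintegral_dirac' _ (by fun_prop), ascPochhammer_eval_zero]
    rcases eq_or_ne m 0 with rfl | hm
    · simp
    · simp [hm]
  have ham : 0 < a + m := by positivity
  have hC : 0 ≤ (ascPochhammer ℝ m).eval a * (1 + t) ^ (-(a + m)) :=
    mul_nonneg (ascPochhammer_eval_nonneg ha.le _) (by positivity)
  rw [gammaLaw, if_neg ha.ne', gammaMeasure,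
    lintegral_withDensity_eq_lintegral_mul _ (measurable_gammaPDF a 1)
      (by fun_prop)]
  -- Write the constant as itself times the total mass of Gamma(a + m, 1 + t), so that only
  -- densities have to be compared.
  rw [← mul_one (ENNReal.ofReal (_ * _)), ← lintegral_gammaPDF_eq_one ham ht1,
    ← lintegral_const_mul _ (measurable_gammaPDF _ _)]
  refine lintegral_congr_ae ?_
  filter_upwards [Measure.ae_ne volume (0 : ℝ)] with g hg
  rcases lt_or_gt_of_ne hg with h' | h'
  · simp [gammaPDF_of_neg h']
  · rw [Pi.mul_apply, gammaPDF_of_nonneg h'.le, gammaPDF_of_nonneg h'.le,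
      ← ENNReal.ofReal_mul (by have := Real.Gamma_pos_of_pos ha; positivity),
      ← ENNReal.ofReal_mul hC, Gamma_add_nat ha]
    congr 1
    have h1 : g ^ (a + m - 1) = g ^ (a - 1) * g ^ m := by
      rw [← Real.rpow_natCast, ← Real.rpow_add h']
      ring_nf
    have h2 : Real.exp (-((1 + t) * g)) = Real.exp (-(1 * g)) * Real.exp (-(t * g)) := by
      rw [← Real.exp_add]
      ring_nf
    have h3 := (Real.Gamma_pos_of_pos ha).ne'
    have h4 := (ascPochhammer_pos m a ha).ne'
    have h5 : (1 + t) ^ (a + m) ≠ 0 := (Real.rpow_pos_of_pos ht1 _).ne'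
    rw [h1, h2, Real.rpow_neg ht1.le, Real.one_rpow]
    field_simp

variable {ι : Type*} [Fintype ι]

theorem ae_nonneg_pi_gammaLaw {a : ι → ℝ} (ha : ∀ i, 0 ≤ a i) :
    ∀ᵐ g ∂(Measure.pi fun i => gammaLaw (a i)), ∀ i, 0 ≤ g i := by
  have hp : ∀ i, IsProbabilityMeasure (gammaLaw (a i)) := fun i =>
    isProbabilityMeasure_gammaLaw (ha i)
  exact ae_all_iff.2 fun i => Measure.tendsto_eval_ae_ae.eventually (ae_nonneg_gammaLaw (ha i))

theorem ae_sum_pos_pi_gammaLaw {a : ι → ℝ} (ha : ∀ i, 0 ≤ a i) (hs : 0 < ∑ i, a i) :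
    ∀ᵐ g ∂(Measure.pi fun i => gammaLaw (a i)), 0 < ∑ i, g i := by
  have hp : ∀ i, IsProbabilityMeasure (gammaLaw (a i)) := fun i =>
    isProbabilityMeasure_gammaLaw (ha i)
  obtain ⟨j, hj, hj'⟩ := Finset.exists_lt_of_sum_lt (f := fun _ => (0 : ℝ)) (by simpa using hs)
  have h1 : ∀ᵐ g ∂(Measure.pi fun i => gammaLaw (a i)), 0 < g j :=
    Measure.tendsto_eval_ae_ae.eventually (ae_pos_gammaLaw hj')
  filter_upwards [ae_nonneg_pi_gammaLaw ha, h1] with g hg hgj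
  exact Finset.sum_pos' (fun i _ => hg i) ⟨j, hj, hgj⟩

theorem lintegral_pi_gammaLaw {a : ι → ℝ} (ha : ∀ i, 0 ≤ a i) {t : ℝ} (ht : 0 ≤ t) (m : ι → ℕ) :
    ∫⁻ g, ENNReal.ofReal ((∏ i, g i ^ m i) * Real.exp (-(t * ∑ i, g i)))
        ∂(Measure.pi fun i => gammaLaw (a i))
      = ENNReal.ofReal ((∏ i, (ascPochhammer ℝ (m i)).eval (a i))
        * (1 + t) ^ (-(∑ i, a i + ∑ i, m i : ℝ))) := by
  have hp : ∀ i, IsProbabilityMeasure (gammaLaw (a i)) := fun i =>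
    isProbabilityMeasure_gammaLaw (ha i)
  have ht1 : 0 < 1 + t := by linarith
  have hind := iIndepFun_pi (μ := fun i => gammaLaw (a i))
    (X := fun i g => ENNReal.ofReal (g ^ m i * Real.exp (-(t * g)))) (fun i => by fun_prop)
  have key := lintegral_prod_eq_prod_lintegral_of_indepFun Finset.univ _ hind
    (fun i => by fun_prop)
  have e1 : ∀ i, ∫⁻ g : ι → ℝ, ENNReal.ofReal (g i ^ m i * Real.exp (-(t * g i)))
      ∂Measure.pi (fun i => gammaLaw (a i))
      = ENNReal.ofReal ((ascPochhammer ℝ (m i)).eval (a i) * (1 + t) ^ (-(a i + m i))) := by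
    intro i
    rw [← lintegral_gammaLaw (ha i) ht,
      ← (measurePreserving_eval (fun i => gammaLaw (a i)) i).lintegral_comp (by fun_prop)]
  simp_rw [e1] at key
  rw [← ENNReal.ofReal_prod_of_nonneg
    (fun i _ => mul_nonneg (ascPochhammer_eval_nonneg (ha i) _) (by positivity)),
    Finset.prod_mul_distrib, ← Real.rpow_sum_of_pos ht1, Finset.sum_neg_distrib,
    Finset.sum_add_distrib, ← Nat.cast_sum] at key
  rw [← key]
  refine lintegral_congr_ae ?_
  filter_upwards [ae_nonneg_pi_gammaLaw ha] with g hg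
  rw [← ENNReal.ofReal_prod_of_nonneg
    (fun i _ => mul_nonneg (pow_nonneg (hg i) _) (by positivity)), Finset.prod_mul_distrib,
    ← Real.exp_sum, Finset.sum_neg_distrib, Finset.mul_sum]

theorem measurable_normalize : Measurable fun (g : ι → ℝ) i => g i / ∑ j, g j :=
  measurable_pi_lambda _ fun i => by fun_prop

theorem isProbabilityMeasure_dirichletLaw {a : ι → ℝ} (ha : ∀ i, 0 ≤ a i) :
    IsProbabilityMeasure (dirichletLaw a) := by
  have hp : ∀ i, IsProbabilityMeasure (gammaLaw (a i)) := fun i =>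
    isProbabilityMeasure_gammaLaw (ha i)
  exact Measure.isProbabilityMeasure_map measurable_normalize.aemeasurable

theorem ae_nonneg_dirichletLaw {a : ι → ℝ} (ha : ∀ i, 0 ≤ a i) :
    ∀ᵐ w ∂dirichletLaw a, ∀ i, 0 ≤ w i := by
  rw [dirichletLaw, ae_map_iff measurable_normalize.aemeasurable
    (measurableSet_setOfPred.2 (by fun_prop))]
  filter_upwards [ae_nonneg_pi_gammaLaw ha] with g hg i
  exact div_nonneg (hg i) (Finset.sum_nonneg fun j _ => hg j)

theorem ae_sum_le_one_dirichletLaw {a : ι → ℝ} : ∀ᵐ w ∂dirichletLaw a, ∑ i, w i ≤ 1 := by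
  rw [dirichletLaw, ae_map_iff measurable_normalize.aemeasurable
    (measurableSet_le (by fun_prop) measurable_const)]
  refine ae_of_all _ fun g => ?_
  rw [← Finset.sum_div]
  -- The ratio is 1, or 0 when the sum vanishes, since 0 / 0 = 0.
  exact div_self_le_one _

theorem ae_sum_eq_one_dirichletLaw {a : ι → ℝ} (ha : ∀ i, 0 ≤ a i) (hs : 0 < ∑ i, a i) :
    ∀ᵐ w ∂dirichletLaw a, ∑ i, w i = 1 := by
  rw [dirichletLaw, ae_map_iff measurable_normalize.aemeasurable
    (measurableSet_eq_fun (by fun_prop) measurable_const)]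
  filter_upwards [ae_sum_pos_pi_gammaLaw ha hs] with g hg
  rw [← Finset.sum_div, div_self hg.ne']

theorem lintegral_pow_mul_exp {r : ℝ} (hr : 0 < r) (e : ℕ) :
    ∫⁻ t in Set.Ioi (0 : ℝ), ENNReal.ofReal (t ^ e * Real.exp (-(t * r)))
      = ENNReal.ofReal (e.factorial / r ^ (e + 1)) := by
  have he : (0 : ℝ) < e + 1 := by positivity
  have hC : 0 ≤ (e.factorial : ℝ) / r ^ (e + 1) := by positivity
  rw [← mul_one (ENNReal.ofReal (_ / _)), ← lintegral_gammaPDF_eq_one he hr,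
    ← lintegral_const_mul _ (measurable_gammaPDF _ _), ← lintegral_indicator measurableSet_Ioi]
  refine lintegral_congr_ae ?_
  filter_upwards [Measure.ae_ne volume (0 : ℝ)] with t ht
  rcases lt_or_gt_of_ne ht with h | h
  · rw [Set.indicator_of_notMem (by simpa using h.le), gammaPDF_of_neg h, mul_zero]
  · rw [Set.indicator_of_mem (by simpa using h), gammaPDF_of_nonneg h.le,
      ← ENNReal.ofReal_mul hC, Real.Gamma_nat_eq_factorial, add_sub_cancel_right,
      Real.rpow_natCast, ← Nat.cast_succ, Real.rpow_natCast, mul_comm t r]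
    congr 1
    have := hr.ne'
    have := e.factorial_ne_zero
    simp only [Nat.succ_eq_add_one]
    field_simp

/-- Writing (∑ g)^(-(e+1)) as (1/e!) ∫ t^e exp(-t ∑ g) dt decouples the Gamma variables. What
matters is that the second factor depends on `m` only through the degree e + 1; its value is never
computed as an integral. -/
theorem lintegral_dirichletLaw {a : ι → ℝ} (ha : ∀ i, 0 ≤ a i) (hs : 0 < ∑ i, a i) (m : ι → ℕ)
    {e : ℕ} (he : ∑ i, m i = e + 1) :
    ∫⁻ w, ENNReal.ofReal (∏ i, w i ^ m i) ∂dirichletLaw a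
      = ENNReal.ofReal (∏ i, (ascPochhammer ℝ (m i)).eval (a i))
        * ∫⁻ t in Set.Ioi (0 : ℝ), ENNReal.ofReal
          ((e.factorial : ℝ)⁻¹ * t ^ e * (1 + t) ^ (-(∑ i, a i + (e + 1 : ℕ) : ℝ))) := by
  have hp : ∀ i, IsProbabilityMeasure (gammaLaw (a i)) := fun i =>
    isProbabilityMeasure_gammaLaw (ha i)
  have hasc : 0 ≤ ∏ i, (ascPochhammer ℝ (m i)).eval (a i) :=
    Finset.prod_nonneg fun i _ => ascPochhammer_eval_nonneg (ha i) _
  rw [dirichletLaw, lintegral_map (by fun_prop) measurable_normalize]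
  have h1 : ∫⁻ g, ENNReal.ofReal (∏ i, (g i / ∑ j, g j) ^ m i)
        ∂(Measure.pi fun i => gammaLaw (a i))
      = ∫⁻ g, (∫⁻ t in Set.Ioi (0 : ℝ), ENNReal.ofReal ((e.factorial : ℝ)⁻¹ * t ^ e) *
          ENNReal.ofReal ((∏ i, g i ^ m i) * Real.exp (-(t * ∑ i, g i))))
        ∂(Measure.pi fun i => gammaLaw (a i)) := by
    refine lintegral_congr_ae ?_
    filter_upwards [ae_nonneg_pi_gammaLaw ha, ae_sum_pos_pi_gammaLaw ha hs] with g hg hgs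
    have hprod : 0 ≤ ∏ i, g i ^ m i := Finset.prod_nonneg fun i _ => pow_nonneg (hg i) _
    have h2 : ∀ t ∈ Set.Ioi (0 : ℝ), ENNReal.ofReal ((e.factorial : ℝ)⁻¹ * t ^ e) *
          ENNReal.ofReal ((∏ i, g i ^ m i) * Real.exp (-(t * ∑ i, g i)))
        = ENNReal.ofReal ((e.factorial : ℝ)⁻¹ * ∏ i, g i ^ m i)
          * ENNReal.ofReal (t ^ e * Real.exp (-(t * ∑ i, g i))) := by
      intro t ht
      have ht' : 0 < t := ht
      rw [← ENNReal.ofReal_mul (by positivity), ← ENNReal.ofReal_mul (by positivity)]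
      congr 1
      ring
    rw [setLIntegral_congr_fun measurableSet_Ioi h2, lintegral_const_mul _ (by fun_prop),
      lintegral_pow_mul_exp hgs, ← ENNReal.ofReal_mul (by positivity)]
    congr 1
    simp_rw [div_pow]
    rw [Finset.prod_div_distrib, Finset.prod_pow_eq_pow_sum, he]
    have := e.factorial_ne_zero
    field_simp
  rw [h1, lintegral_lintegral_swap (by fun_prop),
    ← lintegral_const_mul _ (by fun_prop)]
  refine setLIntegral_congr_fun measurableSet_Ioi fun t ht => ?_
  have ht' : 0 < t := ht
  rw [lintegral_const_mul _ (by fun_prop), lintegral_pi_gammaLaw ha ht'.le, ← ENNReal.ofReal_mul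
    (by positivity), ← ENNReal.ofReal_mul hasc, he]
  congr 1
  ring

theorem integrable_dirichletLaw {a : ι → ℝ} (ha : ∀ i, 0 ≤ a i) {F : (ι → ℝ) → ℝ}
    (hF : Continuous F) : Integrable F (dirichletLaw a) := by
  have := isProbabilityMeasure_dirichletLaw ha
  have hK : ∀ᵐ w ∂dirichletLaw a, w ∈ Set.Icc (0 : ι → ℝ) 1 := by
    filter_upwards [ae_nonneg_dirichletLaw ha, ae_sum_le_one_dirichletLaw] with w hw hw1
    exact ⟨hw, fun i => (Finset.single_le_sum (fun j _ => hw j) (Finset.mem_univ i)).trans hw1⟩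
  rw [← Measure.restrict_eq_self_of_ae_mem hK]
  exact hF.continuousOn.integrableOn_compact isCompact_Icc

/-- In each positive degree the moments are products of rising factorials times a common constant.
Inserting 1 = ∑ w_i into a monomial of the previous degree determines that constant by induction. -/
theorem integral_prod_pow_dirichletLaw {a : ι → ℝ} (ha : ∀ i, 0 ≤ a i) (hs : 0 < ∑ i, a i)
    {d : ℕ} (m : ι → ℕ) (hm : ∑ i, m i = d) :
    ∫ w, ∏ i, w i ^ m i ∂dirichletLaw a
      = (∏ i, (ascPochhammer ℝ (m i)).eval (a i)) / (ascPochhammer ℝ d).eval (∑ i, a i) := by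
  classical
  have hprob := isProbabilityMeasure_dirichletLaw ha
  have hcont : ∀ m : ι → ℕ, Continuous fun w : ι → ℝ => ∏ i, w i ^ m i := fun m => by fun_prop
  induction d generalizing m with
  | zero =>
    have : ∀ i, m i = 0 := by simpa using hm
    simp [this]
  | succ e ih =>
    obtain ⟨c, hc⟩ : ∃ c : ℝ, ∀ m : ι → ℕ, ∑ i, m i = e + 1 →
        ∫ w, ∏ i, w i ^ m i ∂dirichletLaw a
          = (∏ i, (ascPochhammer ℝ (m i)).eval (a i)) * c := by
      refine ⟨(∫⁻ t in Set.Ioi (0 : ℝ), ENNReal.ofReal ((e.factorial : ℝ)⁻¹ * t ^ e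
        * (1 + t) ^ (-(∑ i, a i + (e + 1 : ℕ) : ℝ)))).toReal, fun m hm => ?_⟩
      rw [integral_eq_lintegral_of_nonneg_ae _ (hcont m).aestronglyMeasurable,
        lintegral_dirichletLaw ha hs m hm, ENNReal.toReal_mul, ENNReal.toReal_ofReal
        (Finset.prod_nonneg fun i _ => ascPochhammer_eval_nonneg (ha i) _)]
      filter_upwards [ae_nonneg_dirichletLaw ha] with w hw
      exact Finset.prod_nonneg fun i _ => pow_nonneg (hw i) _
    rw [hc m hm, div_eq_mul_inv]
    congr 1
    -- A coordinate with positive parameter: the moment of w_j^e is then nonzero and can be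
    -- cancelled.
    obtain ⟨j, hj, hj'⟩ := Finset.exists_lt_of_sum_lt (f := fun _ => (0 : ℝ)) (by simpa using hs)
    let m₀ : ι → ℕ := fun k => if k = j then e else 0
    have hm₀ : ∑ k, m₀ k = e := by simp [m₀]
    have h1 : ∫ w, ∏ k, w k ^ m₀ k ∂dirichletLaw a
        = ∑ i, ∫ w, ∏ k, w k ^ (m₀ k + if k = i then 1 else 0) ∂dirichletLaw a := by
      rw [← integral_finsetSum _ fun i _ => integrable_dirichletLaw ha (hcont _)]
      refine integral_congr_ae ?_
      filter_upwards [ae_sum_eq_one_dirichletLaw ha hs] with w hw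
      simp_rw [pow_add, Finset.prod_mul_distrib, ← Finset.mul_sum]
      simp [hw]
    have h2 : ∀ i, ∏ k, (ascPochhammer ℝ (m₀ k + if k = i then 1 else 0)).eval (a k)
        = (∏ k, (ascPochhammer ℝ (m₀ k)).eval (a k)) * (a i + m₀ i) := fun i => by
      have : ∀ k, (ascPochhammer ℝ (m₀ k + if k = i then 1 else 0)).eval (a k)
          = (ascPochhammer ℝ (m₀ k)).eval (a k) * if k = i then a k + m₀ k else 1 := fun k => by
        split_ifs
        · rw [ascPochhammer_succ_eval]
        · simp
      simp_rw [this, Finset.prod_mul_distrib]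
      simp
    have h3 : ∀ i, ∑ k, (m₀ k + if k = i then 1 else 0) = e + 1 := fun i => by
      simp [Finset.sum_add_distrib, hm₀]
    have h4 : (∏ k, (ascPochhammer ℝ (m₀ k)).eval (a k)) ≠ 0 := by
      refine Finset.prod_ne_zero_iff.2 fun k _ => ?_
      by_cases hk : k = j
      · rw [hk]; exact (ascPochhammer_pos _ _ hj').ne'
      · simp [m₀, hk]
    rw [ih m₀ hm₀, Finset.sum_congr rfl fun i _ => hc _ (h3 i)] at h1
    simp_rw [h2, mul_assoc, ← Finset.mul_sum, ← Finset.sum_mul, Finset.sum_add_distrib,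
      ← Nat.cast_sum, hm₀, div_eq_mul_inv] at h1
    have h5 := mul_left_cancel₀ h4 h1
    have h6 : (∑ i, a i + e : ℝ) ≠ 0 := by positivity
    rw [ascPochhammer_succ_eval, mul_inv, h5]
    field_simp

theorem integral_prod_comp_dirichletLaw [DecidableEq ι] {a : ι → ℝ} (ha : ∀ i, 0 ≤ a i)
    (hs : 0 < ∑ i, a i) {d : ℕ} (v : Fin d → ι) :
    ∫ w, ∏ k, w (v k) ∂dirichletLaw a
      = (∏ i, (ascPochhammer ℝ (Finset.univ.filter fun k => v k = i).card).eval (a i))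
        / (ascPochhammer ℝ d).eval (∑ i, a i) := by
  rw [← integral_prod_pow_dirichletLaw ha hs _ (by
    simpa using (Finset.card_eq_sum_card_fiberwise (s := Finset.univ) (t := Finset.univ) (f := v)
      (by simp)).symm)]
  congr 1 with w
  rw [← Finset.prod_fiberwise (s := Finset.univ) (g := v)]
  refine Finset.prod_congr rfl fun i _ => ?_
  rw [Finset.prod_congr rfl (g := fun _ => w i) (by simp +contextual), Finset.prod_const]

theorem integral_mul_dirichletLaw [DecidableEq ι] {a : ι → ℝ} (ha : ∀ i, 0 ≤ a i)
    (hs : 0 < ∑ i, a i) (i j : ι) :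
    ∫ w, w i * w j ∂dirichletLaw a
      = (a i * a j + if i = j then a i else 0) / ((∑ i, a i) * (∑ i, a i + 1)) := by
  have h := integral_prod_pow_dirichletLaw ha hs (d := 2)
    (fun k => (if k = i then 1 else 0) + if k = j then 1 else 0) (by
      simp [Finset.sum_add_distrib])
  simp only [pow_add, Finset.prod_mul_distrib, pow_ite, pow_one, pow_zero, Finset.prod_ite_eq',
    Finset.mem_univ, if_true] at h
  rw [h]
  have h2 : (ascPochhammer ℝ 2).eval (∑ i, a i) = (∑ i, a i) * (∑ i, a i + 1) := by
    simp [ascPochhammer_succ_eval]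
  rw [h2]
  congr 1
  have : ∀ k, (ascPochhammer ℝ ((if k = i then 1 else 0) + if k = j then 1 else 0)).eval (a k)
      = (if k = i then a k else 1) * (if k = j then a k + (if k = i then 1 else 0) else 1) := by
    intro k
    split_ifs <;> simp [ascPochhammer_succ_eval]
  simp_rw [this, Finset.prod_mul_distrib]
  simp only [Finset.prod_ite_eq', Finset.mem_univ, if_true]
  split_ifs with h3 h4 h4
  · subst h3; ring
  · exact absurd h3.symm h4
  · exact absurd h4.symm h3
  · ring

/-- Only E[w_i w_j] is needed. The a_i a_j part recombines to a squared norm, to which the law of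
large numbers applies; the diagonal correction leaves the sum of squares. -/
theorem integral_norm_sq_dirichletLaw {H : Type*} [NormedAddCommGroup H] [InnerProductSpace ℝ H]
    {a : ι → ℝ} (ha : ∀ i, 0 ≤ a i) (hs : 0 < ∑ i, a i) (ξ : ι → H) :
    ∫ w, ‖∑ i, w i • ξ i‖ ^ 2 ∂dirichletLaw a
      = (‖∑ i, a i • ξ i‖ ^ 2 + ∑ i, a i * ‖ξ i‖ ^ 2) / ((∑ i, a i) * (∑ i, a i + 1)) := by
  classical
  simp only [← real_inner_self_eq_norm_sq, sum_inner, inner_sum, real_inner_smul_left,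
    real_inner_smul_right]
  rw [integral_finsetSum _ fun i _ => integrable_dirichletLaw ha (by fun_prop),
    Finset.sum_congr rfl fun i _ => integral_finsetSum _ fun j _ =>
      integrable_dirichletLaw ha (by fun_prop)]
  have : ∀ i j, ∫ w, w i * (w j * inner ℝ (ξ j) (ξ i)) ∂dirichletLaw a
      = (a i * a j + if i = j then a i else 0) / ((∑ i, a i) * (∑ i, a i + 1))
        * inner ℝ (ξ j) (ξ i) := fun i j => by
    rw [← integral_mul_dirichletLaw ha hs, ← integral_mul_const]
    simp_rw [mul_assoc]
  simp_rw [this, div_mul_eq_mul_div, ← Finset.sum_div, add_mul, Finset.sum_add_distrib]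
  simp [mul_assoc]

/-- Moments of Dirichlet weights with parameters at most `r` and total mass at least `N`. -/
theorem integral_prod_sum_dirichletLaw_le {a : ι → ℝ} (ha : ∀ i, 0 ≤ a i) {r N : ℝ}
    (har : ∀ i, a i ≤ r) (hN : 0 < N) (hNa : N ≤ ∑ i, a i) {d : ℕ} {F : Fin d → ι → ℝ}
    (hF : ∀ k i, 0 ≤ F k i) :
    ∫ w, ∏ k, ∑ i, w i * F k i ∂dirichletLaw a ≤ ((r + d) / N) ^ d * ∏ k, ∑ i, F k i := by
  classical
  have hs := hN.trans_le hNa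
  have hasc : ∀ (c : ℕ), c ≤ d → ∀ i, (ascPochhammer ℝ c).eval (a i) ≤ (r + d) ^ c := by
    intro c
    induction c with
    | zero => simp
    | succ c ih =>
      intro hc i
      rw [ascPochhammer_succ_eval, pow_succ]
      have hcd : (c : ℝ) ≤ d := by exact_mod_cast (Nat.le_of_succ_le hc)
      have := ha i
      exact mul_le_mul (ih (Nat.le_of_succ_le hc) i) (add_le_add (har i) hcd) (by positivity)
        (pow_nonneg (by linarith [har i, Nat.cast_nonneg (α := ℝ) d]) _)
  have hasc' : ∀ c : ℕ, N ^ c ≤ (ascPochhammer ℝ c).eval (∑ i, a i) := by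
    intro c
    induction c with
    | zero => simp
    | succ c ih =>
      rw [ascPochhammer_succ_eval, pow_succ]
      exact mul_le_mul ih (by linarith [Nat.cast_nonneg (α := ℝ) c]) hN.le
        (ascPochhammer_eval_nonneg hs.le _)
  -- The fibres of `v` have total size d, so the rising factorials contribute at most (r + d)^d,
  -- against a denominator of at least N^d.
  have hmom : ∀ v : Fin d → ι, ∫ w, ∏ k, w (v k) ∂dirichletLaw a ≤ ((r + d) / N) ^ d := by
    intro v
    rw [integral_prod_comp_dirichletLaw ha hs, div_pow]
    have hcard := (Finset.card_eq_sum_card_fiberwise (s := Finset.univ) (t := Finset.univ)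
      (f := v) (by simp)).symm
    rw [Finset.card_fin] at hcard
    refine div_le_div₀ ?_ ?_ (by positivity) (hasc' d)
    · cases isEmpty_or_nonempty ι with
      | inl h =>  simp at hs
      | inr h =>
        obtain ⟨i⟩ := h
        exact pow_nonneg (by linarith [ha i, har i, Nat.cast_nonneg (α := ℝ) d]) _
    · calc _ ≤ ∏ i, (r + d) ^ (Finset.univ.filter fun k => v k = i).card :=
            Finset.prod_le_prod (fun i _ => ascPochhammer_eval_nonneg (ha i) _) fun i _ =>
              hasc _ ((Finset.card_filter_le _ _).trans (by simp)) i
        _ = (r + d) ^ d := by rw [Finset.prod_pow_eq_pow_sum, hcard]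
  simp_rw [Finset.prod_univ_sum, Finset.prod_mul_distrib, Finset.mul_sum]
  rw [integral_finsetSum _ fun v _ => integrable_dirichletLaw ha (by fun_prop)]
  refine Finset.sum_le_sum fun v _ => ?_
  rw [integral_mul_const]
  exact mul_le_mul_of_nonneg_right (hmom v) (Finset.prod_nonneg fun k _ => hF k _)

end Dirichlet

/-! ### Second moments of the Dirichlet process -/

section DirichletProcess

variable {S : Type*} [MeasurableSpace S]

/-- The base measure controls the mixed second moments of a random measure. -/
def SecondMomentBound (ν : Measure S) (Q : Measure (Measure S)) : Prop :=
  ∀ f g : S → ENNReal, Measurable f → Measurable g →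
    ∫⁻ M, (∫⁻ z, f z ∂M) * (∫⁻ z, g z ∂M) ∂Q
      ≤ ∫⁻ z, f z * g z ∂ν + (∫⁻ z, f z ∂ν) * ∫⁻ z, g z ∂ν

theorem secondMomentBound_dirac (ν : Measure S) : SecondMomentBound ν (Measure.dirac ν) := by
  intro f g hf hg
  exact (lintegral_dirac' _ ((Measure.measurable_lintegral hf).mul
    (Measure.measurable_lintegral hg))).trans_le le_add_self

/-- The left side is an integral against one measure, the `h`-weighted average of the random
measures. Domination on sets therefore passes to functions. -/
theorem lintegral_mul_lintegral_le {Q : Measure (Measure S)} {ρ : Measure S}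
    {h : Measure S → ENNReal} (hh : Measurable h)
    (hρ : ∀ B, MeasurableSet B → ∫⁻ M, h M * M B ∂Q ≤ ρ B) {g : S → ENNReal} (hg : Measurable g) :
    ∫⁻ M, h M * ∫⁻ z, g z ∂M ∂Q ≤ ∫⁻ z, g z ∂ρ := by
  have hle : (Q.withDensity h).join ≤ ρ := Measure.le_iff.2 fun B hB => by
    rw [Measure.join_apply hB, lintegral_withDensity_eq_lintegral_mul _ hh
      (Measure.measurable_coe hB)]
    exact hρ B hB
  calc ∫⁻ M, h M * ∫⁻ z, g z ∂M ∂Q = ∫⁻ z, g z ∂(Q.withDensity h).join := by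
        rw [Measure.lintegral_join hg.aemeasurable, lintegral_withDensity_eq_lintegral_mul _ hh
          (Measure.measurable_lintegral hg)]
        rfl
    _ ≤ _ := lintegral_mono' hle le_rfl

/-- On the four atoms generated by A and B the law is Dirichlet, which gives the exact value (ν(A ∩
B) + s ν(A) ν(B)) / (s + 1). -/
theorem IsDirichletProcess.lintegral_measure_mul_le {s : ℝ} (hs : 0 < s) {ν : Measure S}
    [IsProbabilityMeasure ν] {Q : Measure (Measure S)}
    (hQ : IsDirichletProcess (ENNReal.ofReal s • ν) Q) {A B : Set S} (hA : MeasurableSet A)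
    (hB : MeasurableSet B) : ∫⁻ M, M A * M B ∂Q ≤ ν (A ∩ B) + ν A * ν B := by
  -- With this ordering A = D 0 ∪ D 1 and B = D 0 ∪ D 2.
  let D : Fin 4 → Set S := ![A ∩ B, A \ B, B \ A, (A ∪ B)ᶜ]
  have hDm : ∀ i, MeasurableSet (D i) := by
    intro i
    fin_cases i
    exacts [hA.inter hB, hA.diff hB, hB.diff hA, (hA.union hB).compl]
  have hDd : Pairwise (Function.onFun Disjoint D) := by
    intro i j hij
    rw [Function.onFun, Set.disjoint_left]
    intro x hi hj
    fin_cases i <;> fin_cases j <;> simp [D] at hij hi hj <;> tauto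
  have hDu : ⋃ i, D i = Set.univ := by
    ext x
    simp only [Set.mem_iUnion, Fin.exists_fin_succ, D]
    simp
    tauto
  have hlaw := hQ.map_partition 4 D hDm hDd hDu
  set a : Fin 4 → ℝ := fun i => ((ENNReal.ofReal s • ν) (D i)).toReal with ha_def
  have ha : ∀ i, a i = s * ν.real (D i) := fun i => by
    simp [ha_def, Measure.real, hs.le]
  have ha0 : ∀ i, 0 ≤ a i := fun i => by rw [ha]; positivity
  have hAB1 : ∀ M : Measure S, IsFiniteMeasure M → M.real A = M.real (D 0) + M.real (D 1) :=
    fun M _ => (measureReal_inter_add_sdiff hB).symm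
  have hAB2 : ∀ M : Measure S, IsFiniteMeasure M → M.real B = M.real (D 0) + M.real (D 2) :=
    fun M _ => by
      rw [← measureReal_inter_add_sdiff (s := B) hA, Set.inter_comm B A]
      rfl
  have hsum : ∑ i, ν.real (D i) = 1 := by
    have h1 : ∑ i, ν.real (D i) = ν.real (A ∪ B) + ν.real (A ∪ B)ᶜ := by
      rw [Fin.sum_univ_four, ← hAB1 ν inferInstance]
      congr 1
      rw [← Set.union_sdiff_self, measureReal_union disjoint_sdiff_self_right (hB.diff hA)]
      rfl
    rw [h1, measureReal_add_measureReal_compl (hA.union hB), probReal_univ]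
  have hsa : ∑ i, a i = s := by simp_rw [ha, ← Finset.mul_sum, hsum, mul_one]
  have hmeas : Measurable fun (M : Measure S) i => (M (D i)).toReal :=
    measurable_pi_lambda _ fun i => (Measure.measurable_coe (hDm i)).ennreal_toReal
  have hcont : Continuous fun w : Fin 4 → ℝ => (w 0 + w 1) * (w 0 + w 2) := by fun_prop
  have e1 : ∫⁻ M, M A * M B ∂Q
      = ∫⁻ w, ENNReal.ofReal ((w 0 + w 1) * (w 0 + w 2)) ∂dirichletLaw a := by
    rw [← hlaw, lintegral_map hcont.measurable.ennreal_ofReal hmeas]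
    refine lintegral_congr_ae ?_
    filter_upwards [hQ.ae_isProbabilityMeasure] with M hM
    have h1 := hAB1 M inferInstance
    have h2 := hAB2 M inferInstance
    simp only [Measure.real] at h1 h2
    rw [← h1, ← h2, ← ENNReal.toReal_mul, ENNReal.ofReal_toReal]
    exact ENNReal.mul_ne_top (measure_ne_top _ _) (measure_ne_top _ _)
  have e2 : ∫ w, (w 0 + w 1) * (w 0 + w 2) ∂dirichletLaw a
      = (s * ν.real (D 0) + s ^ 2 * (ν.real A * ν.real B)) / (s * (s + 1)) := by
    have hint : ∀ i j, Integrable (fun w : Fin 4 → ℝ => w i * w j) (dirichletLaw a) :=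
      fun i j => integrable_dirichletLaw ha0 (by fun_prop)
    have : ∀ w : Fin 4 → ℝ, (w 0 + w 1) * (w 0 + w 2)
        = w 0 * w 0 + w 0 * w 2 + w 1 * w 0 + w 1 * w 2 := fun w => by ring
    simp_rw [this]
    rw [integral_add (integrable_dirichletLaw ha0 (by fun_prop)) (hint _ _),
      integral_add (integrable_dirichletLaw ha0 (by fun_prop)) (hint _ _),
      integral_add (hint _ _) (hint _ _)]
    simp_rw [integral_mul_dirichletLaw ha0 (hsa ▸ hs), hsa, ha, hAB1 ν inferInstance,
      hAB2 ν inferInstance]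
    simp only [if_true, Fin.reduceEq, if_false]
    ring
  rw [e1, ← ofReal_integral_eq_lintegral_ofReal (integrable_dirichletLaw ha0 hcont) (by
    filter_upwards [ae_nonneg_dirichletLaw ha0] with w hw
    exact mul_nonneg (add_nonneg (hw 0) (hw 1)) (add_nonneg (hw 0) (hw 2))), e2]
  rw [← ofReal_measureReal (μ := ν) (s := A ∩ B), ← ofReal_measureReal (μ := ν) (s := A),
    ← ofReal_measureReal (μ := ν) (s := B), ← ENNReal.ofReal_mul (by positivity),
    ← ENNReal.ofReal_add (by positivity) (by positivity)]
  refine ENNReal.ofReal_le_ofReal ?_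
  rw [div_le_iff₀ (by positivity)]
  have h0 : 0 ≤ ν.real (D 0) := by positivity
  have h1 : 0 ≤ ν.real A * ν.real B := by positivity
  change s * ν.real (D 0) + s ^ 2 * (ν.real A * ν.real B)
    ≤ (ν.real (D 0) + ν.real A * ν.real B) * (s * (s + 1))
  nlinarith [mul_nonneg (sq_nonneg s) h0, mul_nonneg hs.le h1]

/-- Extend from pairs of sets to pairs of functions one argument at a time. -/
theorem IsDirichletProcess.secondMomentBound {s : ℝ} (hs : 0 < s) {ν : Measure S}
    [IsProbabilityMeasure ν] {Q : Measure (Measure S)}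
    (hQ : IsDirichletProcess (ENNReal.ofReal s • ν) Q) : SecondMomentBound ν Q := by
  intro f g hf hg
  have h1 : ∀ B, MeasurableSet B →
      ∫⁻ M, (∫⁻ z, f z ∂M) * M B ∂Q ≤ (ν.withDensity f + (∫⁻ z, f z ∂ν) • ν) B := by
    intro B hB
    simp_rw [mul_comm _ ((_ : Measure S) B)]
    refine (lintegral_mul_lintegral_le (ρ := ν.restrict B + ν B • ν) (Measure.measurable_coe hB)
      (fun A hA => ?_) hf).trans_eq ?_
    · refine (hQ.lintegral_measure_mul_le hs hB hA).trans_eq ?_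
      simp [Measure.restrict_apply hA, Set.inter_comm]
    · rw [lintegral_add_measure, lintegral_smul_measure, Measure.add_apply, Measure.smul_apply,
        withDensity_apply _ hB, smul_eq_mul, smul_eq_mul, mul_comm]
  refine (lintegral_mul_lintegral_le (Measure.measurable_lintegral hf) h1 hg).trans_eq ?_
  rw [lintegral_add_measure, lintegral_smul_measure, smul_eq_mul,
    lintegral_withDensity_eq_lintegral_mul _ hf hg]
  rfl

end DirichletProcess

/-! ### Strong law of large numbers without separability -/

section StrongLaw

variable {S H : Type*} [MeasurableSpace S] [NormedAddCommGroup H] [InnerProductSpace ℝ H]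

theorem IsFeature.sub_const {φ : S → H} (h : IsFeature φ) (m : H) :
    IsFeature fun z => φ z - m where
  measurable_inner f := by
    simp_rw [inner_sub_left]
    exact (h.measurable_inner f).sub_const _
  measurable_kernel := by
    simp_rw [inner_sub_left, inner_sub_right]
    refine (h.measurable_kernel.sub ((h.measurable_inner m).comp measurable_fst)).sub
      (Measurable.sub_const ?_ _)
    have : (fun p : S × S => inner ℝ m (φ p.2)) = fun p => inner ℝ (φ p.2) m :=
      funext fun p => real_inner_comm _ _
    rw [this]
    exact (h.measurable_inner m).comp measurable_snd

theorem IsFeature.indicator {φ : S → H} (h : IsFeature φ) {A : Set S} (hA : MeasurableSet A) :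
    IsFeature (A.indicator φ) where
  measurable_inner f := by
    have : (fun z => inner ℝ (A.indicator φ z) f) = A.indicator fun z => inner ℝ (φ z) f := by
      funext z
      by_cases hz : z ∈ A <;> simp [hz]
    rw [this]
    exact (h.measurable_inner f).indicator hA
  measurable_kernel := by
    have : (fun p : S × S => inner ℝ (A.indicator φ p.1) (A.indicator φ p.2))
        = (A ×ˢ A).indicator fun p => inner ℝ (φ p.1) (φ p.2) := by
      funext p
      by_cases h1 : p.1 ∈ A <;> by_cases h2 : p.2 ∈ A <;> simp [h1, h2]
    rw [this]
    exact h.measurable_kernel.indicator (hA.prod hA)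

theorem hasMean_const (P : Measure S) [IsProbabilityMeasure P] (m : H) :
    HasMean (fun _ => m) P m where
  integrable f := integrable_const _
  integral_eq f := by simp

/-- Averages of a nonnegative sequence are uniformly integrable. -/
def TailSmall (c : ℕ → ℝ) : Prop :=
  ∀ ε : ℝ, 0 < ε → ∃ K : ℕ, ∀ᶠ n : ℕ in atTop,
    ∑ i ∈ Finset.range n, (if (K : ℝ) < c i then c i else 0) ≤ ε * n

/-- With k = ⌊√n⌋, at most 2k steps separate k² from n, and an increase of 2kR is negligible against
k². -/
theorem tendsto_div_of_tendsto_sq {T : ℕ → ℝ} {R : ℝ} (hT0 : ∀ n, 0 ≤ T n) (hR : 0 ≤ R)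
    (hT : ∀ n k, T (n + k) ≤ T n + R * k)
    (h : Tendsto (fun k : ℕ => T (k ^ 2) / (k : ℝ) ^ 2) atTop (𝓝 0)) :
    Tendsto (fun n : ℕ => T n / n) atTop (𝓝 0) := by
  have hsqrt : Tendsto Nat.sqrt atTop atTop :=
    tendsto_atTop.2 fun b => eventually_atTop.2 ⟨b * b, fun n hn => Nat.le_sqrt.2 hn⟩
  have h1 : Tendsto (fun k : ℕ => T (k ^ 2) / (k : ℝ) ^ 2 + 2 * R / (k : ℝ)) atTop (𝓝 0) := by
    simpa using h.add (tendsto_const_nhds.div_atTop tendsto_natCast_atTop_atTop)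
  refine tendsto_of_tendsto_of_tendsto_of_le_of_le' tendsto_const_nhds (h1.comp hsqrt)
    (Eventually.of_forall fun n => div_nonneg (hT0 n) (Nat.cast_nonneg n)) ?_
  filter_upwards [eventually_ge_atTop 1] with n hn
  have hk : 0 < n.sqrt := Nat.sqrt_pos.2 hn
  have h2 : n.sqrt ^ 2 ≤ n := by rw [sq]; exact Nat.sqrt_le n
  have h3 : n - n.sqrt ^ 2 ≤ 2 * n.sqrt := by
    have := Nat.sqrt_le_add n
    rw [sq]; omega
  have h4 := hT (n.sqrt ^ 2) (n - n.sqrt ^ 2)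
  rw [Nat.add_sub_cancel' h2] at h4
  have h5 : ((n - n.sqrt ^ 2 : ℕ) : ℝ) ≤ 2 * n.sqrt := by exact_mod_cast h3
  have h6 : ((n.sqrt : ℝ)) ^ 2 ≤ n := by exact_mod_cast h2
  have hk' : (0 : ℝ) < n.sqrt := by exact_mod_cast hk
  calc T n / n ≤ (T (n.sqrt ^ 2) + R * (2 * n.sqrt)) / (n.sqrt : ℝ) ^ 2 := by
        refine div_le_div₀ ?_ ?_ (by positivity) h6
        · have := hT0 (n.sqrt ^ 2); positivity
        · exact h4.trans (by gcongr)
    _ = _ := by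
        simp only [Function.comp]
        field_simp

variable {Ω : Type*} [MeasurableSpace Ω] {μ : Measure Ω} {P : Measure S} {Z : ℕ → Ω → S}

theorem ae_tendsto_average (hlaw : ∀ i, HasLaw (Z i) P μ) (hindep : iIndepFun Z μ) {f : S → ℝ}
    (hf : Measurable f) (hfP : Integrable f P) :
    ∀ᵐ ω ∂μ, Tendsto (fun n : ℕ => (∑ i ∈ Finset.range n, f (Z i ω)) / n) atTop
      (𝓝 (∫ z, f z ∂P)) := by
  have hident : ∀ i, IdentDistrib (f ∘ Z i) (f ∘ Z 0) μ μ := fun i =>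
    IdentDistrib.comp ⟨(hlaw i).aemeasurable, (hlaw 0).aemeasurable,
      (hlaw i).map_eq.trans (hlaw 0).map_eq.symm⟩ hf
  have h := strong_law_ae_real (fun i => f ∘ Z i)
    (by
      have := (hlaw 0).map_eq ▸ hfP
      exact this.comp_aemeasurable (hlaw 0).aemeasurable)
    (fun i j hij => (hindep.indepFun hij).comp hf hf) hident
  have e : ∫ ω, (f ∘ Z 0) ω ∂μ = ∫ z, f z ∂P := by
    rw [← (hlaw 0).map_eq, integral_map (hlaw 0).aemeasurable hf.aestronglyMeasurable]
    rfl
  rw [e] at h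
  exact h

theorem tendsto_integral_tail {f : S → ℝ} (hf : Measurable f) (hf0 : ∀ z, 0 ≤ f z)
    (hfP : Integrable f P) :
    Tendsto (fun K : ℕ => ∫ z, (if (K : ℝ) < f z then f z else 0) ∂P) atTop (𝓝 0) := by
  refine (tendsto_integral_of_dominated_convergence (f := fun _ => 0) f (fun K => ?_) hfP
    (fun K => ?_) ?_).trans_eq (by simp)
  · exact (Measurable.ite (measurableSet_lt measurable_const hf) hf
      measurable_const).aestronglyMeasurable
  · refine ae_of_all _ fun z => ?_
    split_ifs
    · rw [Real.norm_of_nonneg (hf0 z)]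
    · simpa using hf0 z
  · refine ae_of_all _ fun z => tendsto_const_nhds.congr' ?_
    obtain ⟨K₀, hK₀⟩ := exists_nat_ge (f z)
    filter_upwards [eventually_ge_atTop K₀] with K hK
    rw [if_neg (not_lt.2 (hK₀.trans (by exact_mod_cast hK)))]

theorem integrable_tail {f : S → ℝ} (hf : Measurable f) (hfP : Integrable f P) (K : ℕ) :
    Integrable (fun z => if (K : ℝ) < f z then f z else 0) P :=
  hfP.indicator (measurableSet_lt measurable_const hf)

/-- The scalar strong law, applied to the tails f·1{f > K} for all integers K simultaneously, and a
K whose tail has mean below ε. -/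
theorem ae_tailSmall (hlaw : ∀ i, HasLaw (Z i) P μ) (hindep : iIndepFun Z μ) {f : S → ℝ}
    (hf : Measurable f) (hf0 : ∀ z, 0 ≤ f z) (hfP : Integrable f P) :
    ∀ᵐ ω ∂μ, TailSmall fun i => f (Z i ω) := by
  have h := ae_all_iff.2 fun K : ℕ => ae_tendsto_average hlaw hindep
    (Measurable.ite (measurableSet_lt (measurable_const (a := (K : ℝ))) hf) hf measurable_const)
    (integrable_tail hf hfP K)
  filter_upwards [h] with ω hω ε hε
  obtain ⟨K, hK⟩ := ((tendsto_integral_tail hf hf0 hfP).eventually (gt_mem_nhds hε)).exists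
  refine ⟨K, ?_⟩
  filter_upwards [(hω K).eventually (gt_mem_nhds hK), eventually_gt_atTop 0] with n hn hn0
  have : (0 : ℝ) < n := by exact_mod_cast hn0
  exact ((div_lt_iff₀ this).1 hn).le

variable [IsProbabilityMeasure μ] [IsProbabilityMeasure P]

/-- For independent Z_i, Z_j the cross term integrates to the squared norm of the mean, which is 0;
only n diagonal terms, each at most R², remain. -/
theorem integral_norm_sum_sq_le (hlaw : ∀ i, HasLaw (Z i) P μ) (hindep : iIndepFun Z μ)
    {ξ : S → H} (hξ : IsFeature ξ) {R : ℝ} (hR : ∀ z, ‖ξ z‖ ≤ R) (hm : HasMean ξ P 0) (n : ℕ) :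
    Integrable (fun ω => ‖∑ i ∈ Finset.range n, ξ (Z i ω)‖ ^ 2) μ ∧
      ∫ ω, ‖∑ i ∈ Finset.range n, ξ (Z i ω)‖ ^ 2 ∂μ ≤ R ^ 2 * n := by
  have hnorm : Integrable (fun z => ‖ξ z‖) P :=
    Integrable.of_bound hξ.measurable_norm.aestronglyMeasurable R
      (ae_of_all _ fun z => by simpa using hR z)
  have hpair : ∀ i j, AEMeasurable (fun ω => (Z i ω, Z j ω)) μ := fun i j =>
    (hlaw i).aemeasurable.prodMk (hlaw j).aemeasurable
  have hbound : ∀ z z', ‖inner ℝ (ξ z) (ξ z')‖ ≤ R ^ 2 := fun z z' =>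
    (norm_inner_le_norm _ _).trans (by
      rw [sq]
      exact mul_le_mul (hR z) (hR z') (norm_nonneg _) ((norm_nonneg _).trans (hR z)))
  have hint : ∀ i j, Integrable (fun ω => inner ℝ (ξ (Z i ω)) (ξ (Z j ω))) μ := fun i j =>
    Integrable.of_bound (hξ.measurable_kernel.comp_aemeasurable (hpair i j)).aestronglyMeasurable
      (R ^ 2) (ae_of_all _ fun ω => hbound _ _)
  have hzero : ∀ i j, i ≠ j → ∫ ω, inner ℝ (ξ (Z i ω)) (ξ (Z j ω)) ∂μ = 0 := fun i j hij => by
    have h1 := (indepFun_iff_map_prod_eq_prod_map_map (hlaw i).aemeasurable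
      (hlaw j).aemeasurable).1 (hindep.indepFun hij)
    rw [(hlaw i).map_eq, (hlaw j).map_eq] at h1
    have h2 := hm.integral_kernel hξ hnorm
    rw [← h1, integral_map (hpair i j) hξ.measurable_kernel.aestronglyMeasurable] at h2
    simpa using h2
  have hexp : ∀ ω, ‖∑ i ∈ Finset.range n, ξ (Z i ω)‖ ^ 2
      = ∑ i ∈ Finset.range n, ∑ j ∈ Finset.range n, inner ℝ (ξ (Z j ω)) (ξ (Z i ω)) := fun ω => by
    rw [← real_inner_self_eq_norm_sq]
    simp_rw [inner_sum, sum_inner]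
  simp_rw [hexp]
  refine ⟨integrable_finsetSum _ fun i _ => integrable_finsetSum _ fun j _ => hint _ _, ?_⟩
  rw [integral_finsetSum _ fun i _ => integrable_finsetSum _ fun j _ => hint _ _]
  calc _ ≤ ∑ i ∈ Finset.range n, R ^ 2 := by
        refine Finset.sum_le_sum fun i hi => ?_
        rw [integral_finsetSum _ fun j _ => hint _ _, Finset.sum_eq_single_of_mem i hi
          fun j _ hj => hzero j i hj]
        refine (Real.le_norm_self _).trans ((norm_integral_le_of_norm_le_const (C := R ^ 2)
          (ae_of_all _ fun ω => hbound _ _)).trans (by simp))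
    _ = _ := by simp [mul_comm]

/-- At times k² the normalized second moments are at most R²/k², hence summable, so their terms tend
to 0 almost surely; bounded increments fill the gaps. -/
theorem ae_tendsto_norm_average_of_bounded (hlaw : ∀ i, HasLaw (Z i) P μ)
    (hindep : iIndepFun Z μ) {ξ : S → H} (hξ : IsFeature ξ) {R : ℝ} (hR : ∀ z, ‖ξ z‖ ≤ R)
    (hm : HasMean ξ P 0) :
    ∀ᵐ ω ∂μ, Tendsto (fun n : ℕ => ‖∑ i ∈ Finset.range n, ξ (Z i ω)‖ / n) atTop (𝓝 0) := by
  let F : ℕ → Ω → ℝ := fun k ω =>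
    ‖∑ i ∈ Finset.range (k ^ 2), ξ (Z i ω)‖ ^ 2 / (k : ℝ) ^ 4
  have hF0 : ∀ k ω, 0 ≤ F k ω := fun k ω => by positivity
  have hFi : ∀ k, Integrable (F k) μ := fun k =>
    (integral_norm_sum_sq_le hlaw hindep hξ hR hm _).1.div_const _
  have hFl : ∀ k, ∫ ω, F k ω ∂μ ≤ R ^ 2 * (1 / (k : ℝ) ^ 2) := fun k => by
    rw [integral_div]
    rcases Nat.eq_zero_or_pos k with rfl | hk
    · simp
    · have : (0 : ℝ) < k := by exact_mod_cast hk
      rw [div_le_iff₀ (by positivity)]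
      refine (integral_norm_sum_sq_le hlaw hindep hξ hR hm _).2.trans_eq ?_
      push_cast
      field_simp
  have hsum : ∑' k, ∫⁻ ω, ENNReal.ofReal (F k ω) ∂μ ≠ ⊤ := by
    have h1 : ∀ k, ∫⁻ ω, ENNReal.ofReal (F k ω) ∂μ ≤ ENNReal.ofReal (R ^ 2 * (1 / (k : ℝ) ^ 2)) :=
      fun k => by
        rw [← ofReal_integral_eq_lintegral_ofReal (hFi k) (ae_of_all _ (hF0 k))]
        exact ENNReal.ofReal_le_ofReal (hFl k)
    refine ne_top_of_le_ne_top ?_ (ENNReal.tsum_le_tsum h1)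
    exact ((Real.summable_one_div_nat_pow.2 one_lt_two).mul_left _).tsum_ofReal_ne_top
  rw [← lintegral_tsum fun k => (hFi k).aemeasurable.ennreal_ofReal] at hsum
  have hae := ae_lt_top' (AEMeasurable.tsum
    fun k => (hFi k).aemeasurable.ennreal_ofReal) hsum
  filter_upwards [hae] with ω hω
  have hlim := (ENNReal.tendsto_toReal ENNReal.zero_ne_top).comp
    (ENNReal.tendsto_atTop_zero_of_tsum_ne_top hω.ne)
  have hlim' : Tendsto (fun k => F k ω) atTop (𝓝 0) := by
    refine hlim.congr fun k => ?_
    simp [Function.comp, hF0]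
  refine tendsto_div_of_tendsto_sq (R := R) (fun n => norm_nonneg _)
    ((norm_nonneg _).trans (hR (Z 0 ω))) (fun n k => ?_) ?_
  · rw [Finset.sum_range_add]
    refine (norm_add_le _ _).trans (add_le_add le_rfl ?_)
    refine (norm_sum_le _ _).trans ((Finset.sum_le_sum fun i _ => hR _).trans_eq ?_)
    simp [mul_comm]
  · have := hlim'.sqrt
    rw [Real.sqrt_zero] at this
    refine this.congr fun k => ?_
    simp only [F]
    rw [Real.sqrt_div' _ (by positivity), Real.sqrt_sq (norm_nonneg _),
      show (k : ℝ) ^ 4 = ((k : ℝ) ^ 2) ^ 2 by ring, Real.sqrt_sq (by positivity)]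

/-- The strong law of large numbers for weakly measurable maps with values in a Hilbert space
that need not be separable. -/
theorem ae_tendsto_norm_average [CompleteSpace H] (hlaw : ∀ i, HasLaw (Z i) P μ)
    (hindep : iIndepFun Z μ) {φ : S → H} (hφ : IsFeature φ)
    (hφP : Integrable (fun z => ‖φ z‖) P) {m : H} (hm : HasMean φ P m) :
    ∀ᵐ ω ∂μ, Tendsto (fun n : ℕ => ‖∑ i ∈ Finset.range n, (φ (Z i ω) - m)‖ / n) atTop (𝓝 0) := by
  let A : ℕ → Set S := fun K => {z | ‖φ z‖ ≤ K}
  have hA : ∀ K, MeasurableSet (A K) := fun K =>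
    measurableSet_le hφ.measurable_norm measurable_const
  have hAf : ∀ K, IsFeature ((A K).indicator φ) := fun K => hφ.indicator (hA K)
  have hAb : ∀ K z, ‖(A K).indicator φ z‖ ≤ K := fun K z => by
    by_cases hz : z ∈ A K
    · rw [Set.indicator_of_mem hz]
      exact hz
    · simp [hz]
  have hAi : ∀ K, Integrable (fun z => ‖(A K).indicator φ z‖) P := fun K =>
    Integrable.of_bound (hAf K).measurable_norm.aestronglyMeasurable K
      (ae_of_all _ fun z => by simpa using hAb K z)
  choose mA hmA using fun K => (hAf K).exists_hasMean (hAi K)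
  have htail : ∀ K z, ‖φ z - (A K).indicator φ z‖ = if (K : ℝ) < ‖φ z‖ then ‖φ z‖ else 0 := by
    intro K z
    by_cases hz : ‖φ z‖ ≤ K
    · have hz' : z ∈ A K := hz
      simp [hz', not_lt.2 hz]
    · have hz' : z ∉ A K := hz
      simp [hz', not_le.1 hz]
  have hmt : ∀ K, ‖m - mA K‖ ≤ ∫ z, (if (K : ℝ) < ‖φ z‖ then ‖φ z‖ else 0) ∂P := fun K => by
    simp_rw [← htail]
    refine (hm.sub (hmA K)).norm_le ?_
    simp_rw [htail]
    exact integrable_tail hφ.measurable_norm hφP K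
  have h1 := ae_all_iff.2 fun K => ae_tendsto_norm_average_of_bounded hlaw hindep
    ((hAf K).sub_const (mA K)) (R := K + ‖mA K‖)
    (fun z => (norm_sub_le _ _).trans (add_le_add (hAb K z) le_rfl))
    (by simpa using (hmA K).sub (hasMean_const P (mA K)))
  have h2 := ae_all_iff.2 fun K : ℕ => ae_tendsto_average hlaw hindep
    (Measurable.ite (measurableSet_lt (measurable_const (a := (K : ℝ))) hφ.measurable_norm)
      hφ.measurable_norm measurable_const) (integrable_tail hφ.measurable_norm hφP K)
  filter_upwards [h1, h2] with ω hω1 hω2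
  refine tendsto_order.2 ⟨fun x hx => Eventually.of_forall fun n =>
    hx.trans_le (by positivity), fun ε hε => ?_⟩
  obtain ⟨K, hK⟩ := ((tendsto_integral_tail hφ.measurable_norm (fun z => norm_nonneg _)
    hφP).eventually (gt_mem_nhds (show 0 < ε / 3 by positivity))).exists
  filter_upwards [(hω1 K).eventually (gt_mem_nhds (show 0 < ε / 3 by positivity)),
    (hω2 K).eventually (gt_mem_nhds hK), eventually_gt_atTop 0] with n hn1 hn2 hn0
  have hn : (0 : ℝ) < n := by exact_mod_cast hn0
  -- Centred truncated part, tail of the sample, and bias of the truncated mean; each is at most a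
  -- third of ε n.
  have hsplit : ∑ i ∈ Finset.range n, (φ (Z i ω) - m)
      = ∑ i ∈ Finset.range n, ((A K).indicator φ (Z i ω) - mA K)
        + ∑ i ∈ Finset.range n, (φ (Z i ω) - (A K).indicator φ (Z i ω))
        - (n : ℝ) • (m - mA K) := by
    simp only [Finset.sum_sub_distrib, Finset.sum_const, Finset.card_range, smul_sub,
      Nat.cast_smul_eq_nsmul]
    abel
  rw [div_lt_iff₀ hn] at hn1 hn2 ⊢
  have h3 : ‖∑ i ∈ Finset.range n, (φ (Z i ω) - (A K).indicator φ (Z i ω))‖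
      ≤ ∑ i ∈ Finset.range n, if (K : ℝ) < ‖φ (Z i ω)‖ then ‖φ (Z i ω)‖ else 0 := by
    simp_rw [← htail]
    exact norm_sum_le _ _
  have h4 : ‖(n : ℝ) • (m - mA K)‖ ≤ n * (ε / 3) := by
    rw [norm_smul, Real.norm_of_nonneg hn.le]
    exact mul_le_mul_of_nonneg_left ((hmt K).trans hK.le) hn.le
  rw [hsplit]
  have h5 := (norm_sub_le (∑ i ∈ Finset.range n, ((A K).indicator φ (Z i ω) - mA K)
        + ∑ i ∈ Finset.range n, (φ (Z i ω) - (A K).indicator φ (Z i ω))) ((n : ℝ) • (m - mA K)))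
  have h6 := norm_add_le (∑ i ∈ Finset.range n, ((A K).indicator φ (Z i ω) - mA K))
        (∑ i ∈ Finset.range n, (φ (Z i ω) - (A K).indicator φ (Z i ω)))
  linarith

end StrongLaw

/-! ### Dirichlet-weighted sums of centred sequences -/

section Weights

variable {H H' : Type*} [NormedAddCommGroup H] [InnerProductSpace ℝ H]
  [NormedAddCommGroup H'] [InnerProductSpace ℝ H']

/-- The parameters `(s, 1, …, 1)` of the posterior weights. -/
def weightParam (s : ℝ) (n : ℕ) : Fin (n + 1) → ℝ := Fin.cons s fun _ => 1

theorem weightParam_nonneg {s : ℝ} (hs : 0 ≤ s) (n : ℕ) (i : Fin (n + 1)) :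
    0 ≤ weightParam s n i := by
  refine Fin.cases ?_ (fun j => ?_) i <;> simp [weightParam, hs]

theorem weightParam_le {s : ℝ} (hs : 0 ≤ s) (n : ℕ) (i : Fin (n + 1)) :
    weightParam s n i ≤ s + 1 := by
  refine Fin.cases ?_ (fun j => ?_) i <;> simp [weightParam, hs]

theorem sum_weightParam (s : ℝ) (n : ℕ) : ∑ i, weightParam s n i = s + n := by
  simp [weightParam, Fin.sum_univ_succ]

/-- The weighted sum `w 0 • ξ₀ + ∑ i, w (i + 1) • ξ i`. -/
def weightedSum {n : ℕ} (w : Fin (n + 1) → ℝ) (ξ₀ : H) (ξ : ℕ → H) : H :=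
  w 0 • ξ₀ + ∑ i : Fin n, w i.succ • ξ i

theorem weightedSum_eq {n : ℕ} (w : Fin (n + 1) → ℝ) (ξ₀ : H) (ξ : ℕ → H) :
    weightedSum w ξ₀ ξ = ∑ i, w i • (Fin.cons ξ₀ (fun j : Fin n => ξ j) : Fin (n + 1) → H) i := by
  simp [weightedSum, Fin.sum_univ_succ]

theorem continuous_weightedSum {n : ℕ} (ξ₀ : H) (ξ : ℕ → H) :
    Continuous fun w : Fin (n + 1) → ℝ => weightedSum w ξ₀ ξ := by
  unfold weightedSum
  fun_prop

theorem norm_weightedSum_le {n : ℕ} {w : Fin (n + 1) → ℝ} (hw : ∀ i, 0 ≤ w i) (ξ₀ : H)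
    (ξ : ℕ → H) :
    ‖weightedSum w ξ₀ ξ‖ ≤ weightedSum w ‖ξ₀‖ fun i => ‖ξ i‖ := by
  refine (norm_add_le _ _).trans (add_le_add ?_ ((norm_sum_le _ _).trans_eq ?_))
  · rw [norm_smul, Real.norm_of_nonneg (hw 0), smul_eq_mul]
  · refine Finset.sum_congr rfl fun i _ => ?_
    rw [norm_smul, Real.norm_of_nonneg (hw _), smul_eq_mul]

/-- Sequences with vanishing averages whose norms have uniformly integrable averages. -/
structure IsCentered (ξ : ℕ → H) : Prop where
  average : Tendsto (fun n : ℕ => ‖∑ i ∈ Finset.range n, ξ i‖ / n) atTop (𝓝 0)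
  tail : TailSmall fun i => ‖ξ i‖

theorem TailSmall.exists_sum_le {c : ℕ → ℝ} (hc : TailSmall c) :
    ∃ C : ℝ, 0 ≤ C ∧ ∀ᶠ n : ℕ in atTop, ∑ i ∈ Finset.range n, c i ≤ C * n := by
  obtain ⟨K, hK⟩ := hc 1 one_pos
  refine ⟨K + 1, by positivity, ?_⟩
  filter_upwards [hK] with n hn
  calc ∑ i ∈ Finset.range n, c i
      ≤ ∑ i ∈ Finset.range n, ((K : ℝ) + if (K : ℝ) < c i then c i else 0) := by
        refine Finset.sum_le_sum fun i _ => ?_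
        split_ifs with h
        · linarith [Nat.cast_nonneg (α := ℝ) K]
        · linarith [not_lt.1 h]
    _ ≤ (K + 1) * n := by
        rw [Finset.sum_add_distrib]
        simp only [Finset.sum_const, Finset.card_range, nsmul_eq_mul]
        linarith

/-- Every term is at most K plus the tail sum, so the maximum is o(n), while the total is O(n). No
second moment is required. -/
theorem TailSmall.sum_sq_le {c : ℕ → ℝ} (hc : TailSmall c) (hc0 : ∀ i, 0 ≤ c i) {ε : ℝ}
    (hε : 0 < ε) : ∀ᶠ n : ℕ in atTop, ∑ i ∈ Finset.range n, c i ^ 2 ≤ ε * (n : ℝ) ^ 2 := by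
  obtain ⟨C, hC, hCn⟩ := hc.exists_sum_le
  obtain ⟨K, hK⟩ := hc (ε / (2 * (C + 1))) (by positivity)
  have hlarge : ∀ᶠ n : ℕ in atTop, 2 * K * C / ε ≤ (n : ℝ) :=
    tendsto_natCast_atTop_atTop.eventually_ge_atTop _
  filter_upwards [hCn, hK, hlarge] with n h1 h2 h3
  set T := ∑ i ∈ Finset.range n, if (K : ℝ) < c i then c i else 0 with hT
  have hpos : ∀ i, 0 ≤ if (K : ℝ) < c i then c i else 0 := fun i => by
    split_ifs
    exacts [hc0 i, le_rfl]
  have h4 : ∀ i ∈ Finset.range n, c i ^ 2 ≤ (K + T) * c i := fun i hi => by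
    rw [sq]
    refine mul_le_mul_of_nonneg_right ?_ (hc0 i)
    have := Finset.single_le_sum (fun j _ => hpos j) hi
    rw [← hT] at this
    split_ifs at this with h
    · linarith [Nat.cast_nonneg (α := ℝ) K]
    · linarith [not_lt.1 h]
  have hT0 : 0 ≤ T := Finset.sum_nonneg fun i _ => hpos i
  have h5 : (K + T) * (C * n) ≤ (K + ε / (2 * (C + 1)) * n) * (C * n) := by gcongr
  have h6 : 2 * K * C ≤ n * ε := (div_le_iff₀ hε).1 h3
  have h7 : ε / (2 * (C + 1)) * C ≤ ε / 2 := by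
    rw [div_mul_eq_mul_div, div_le_div_iff₀ (by positivity) (by positivity)]
    nlinarith
  calc ∑ i ∈ Finset.range n, c i ^ 2 ≤ (K + T) * ∑ i ∈ Finset.range n, c i := by
        rw [Finset.mul_sum]
        exact Finset.sum_le_sum h4
    _ ≤ (K + T) * (C * n) := by gcongr
    _ ≤ _ := h5
    _ = (K * C) * n + (ε / (2 * (C + 1)) * C) * (n : ℝ) ^ 2 := by ring
    _ ≤ (n * ε / 2) * n + (ε / 2) * (n : ℝ) ^ 2 := by
        gcongr
        linarith
    _ = _ := by ring

/-- Both terms of `integral_norm_sq_dirichletLaw` are o(n²) against a denominator of order n². The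
threshold for n does not depend on ξ₀, so the bound can later be integrated over the prior. -/
theorem IsCentered.eventually_integral_norm_sq_le {ξ : ℕ → H} (hξ : IsCentered ξ) {s : ℝ}
    (hs : 0 ≤ s) {ε : ℝ} (hε : 0 < ε) :
    ∀ᶠ n : ℕ in atTop, ∀ ξ₀ : H,
      ∫ w, ‖weightedSum w ξ₀ ξ‖ ^ 2 ∂dirichletLaw (weightParam s n) ≤ ε * (1 + ‖ξ₀‖ ^ 2) := by
  -- The sample contributes 2δ² + δ ≤ 3δ ≤ ε/2, using δ ≤ 1.
  set δ := min 1 (ε / 6) with hδ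
  have hδ0 : 0 < δ := by positivity
  have hlarge : ∀ᶠ n : ℕ in atTop, 2 * (2 * s ^ 2 + s) / ε + 1 ≤ (n : ℝ) :=
    tendsto_natCast_atTop_atTop.eventually_ge_atTop _
  filter_upwards [hξ.average.eventually (gt_mem_nhds hδ0),
    hξ.tail.sum_sq_le (fun i => norm_nonneg _) hδ0, hlarge] with n h1 h2 h3 ξ₀
  have hsε : 0 ≤ 2 * (2 * s ^ 2 + s) / ε := by positivity
  have hn : (1 : ℝ) ≤ n := by linarith
  have hn0 : (0 : ℝ) < n := by linarith
  simp_rw [weightedSum_eq]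
  rw [integral_norm_sq_dirichletLaw (weightParam_nonneg hs n)
    (by rw [sum_weightParam]; positivity), sum_weightParam, div_le_iff₀ (by positivity)]
  simp only [Fin.sum_univ_succ, weightParam, Fin.cons_zero, Fin.cons_succ, one_smul, one_mul]
  rw [← Finset.sum_range (fun i => ξ i), ← Finset.sum_range (fun i => ‖ξ i‖ ^ 2)]
  rw [div_lt_iff₀ hn0] at h1
  have h4 : ‖s • ξ₀ + ∑ i ∈ Finset.range n, ξ i‖ ≤ s * ‖ξ₀‖ + δ * n := by
    refine (norm_add_le _ _).trans (add_le_add ?_ h1.le)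
    rw [norm_smul, Real.norm_of_nonneg hs]
  have h5 : ‖s • ξ₀ + ∑ i ∈ Finset.range n, ξ i‖ ^ 2
      ≤ 2 * s ^ 2 * ‖ξ₀‖ ^ 2 + 2 * δ * (n : ℝ) ^ 2 := by
    calc _ ≤ (s * ‖ξ₀‖ + δ * n) ^ 2 := by gcongr
      _ ≤ 2 * (s * ‖ξ₀‖) ^ 2 + 2 * (δ * n) ^ 2 := by nlinarith [sq_nonneg (s * ‖ξ₀‖ - δ * n)]
      _ = 2 * s ^ 2 * ‖ξ₀‖ ^ 2 + 2 * (δ * δ) * (n : ℝ) ^ 2 := by ring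
      _ ≤ _ := by
        gcongr
        exact mul_le_of_le_one_left hδ0.le (min_le_left _ _)
  have h6 : 2 * (2 * s ^ 2 + s) ≤ n * ε := by
    have := (div_le_iff₀ hε).1 (show 2 * (2 * s ^ 2 + s) / ε ≤ (n : ℝ) by linarith)
    exact this
  have h7 : 3 * δ ≤ ε / 2 := by
    have := min_le_right 1 (ε / 6)
    rw [← hδ] at this
    linarith
  have h8 : (n : ℝ) ≤ (n : ℝ) ^ 2 := by nlinarith
  have h9 : (n : ℝ) ^ 2 ≤ (s + n) * (s + n + 1) := by nlinarith
  have hx := sq_nonneg ‖ξ₀‖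
  calc _ ≤ (2 * s ^ 2 + s) * ‖ξ₀‖ ^ 2 + 3 * δ * (n : ℝ) ^ 2 := by linarith
    _ ≤ (n * ε / 2) * ‖ξ₀‖ ^ 2 + ε / 2 * (n : ℝ) ^ 2 := by
        gcongr
        linarith
    _ ≤ ((n : ℝ) ^ 2 * ε / 2) * ‖ξ₀‖ ^ 2 + ε / 2 * (n : ℝ) ^ 2 := by gcongr
    _ ≤ (ε * (1 + ‖ξ₀‖ ^ 2)) * (n : ℝ) ^ 2 := by
        have : 0 ≤ ε * (n : ℝ) ^ 2 * (1 + ‖ξ₀‖ ^ 2) := by positivity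
        nlinarith
    _ ≤ _ := by gcongr

/-- A degree-four moment: `integral_prod_sum_dirichletLaw_le` with d = 4, r = s + 1 and N = n. -/
theorem integral_weightedSum_sq_mul_sq_le {s : ℝ} (hs : 0 ≤ s) {n : ℕ} (hn : 0 < n)
    {a₀ b₀ : ℝ} {a b : ℕ → ℝ} (ha₀ : 0 ≤ a₀) (hb₀ : 0 ≤ b₀) (ha : ∀ i, 0 ≤ a i)
    (hb : ∀ i, 0 ≤ b i) :
    ∫ w : Fin (n + 1) → ℝ, weightedSum w a₀ a ^ 2 * weightedSum w b₀ b ^ 2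
        ∂dirichletLaw (weightParam s n)
      ≤ ((s + 5) / n) ^ 4 * ((a₀ + ∑ i ∈ Finset.range n, a i) ^ 2
        * (b₀ + ∑ i ∈ Finset.range n, b i) ^ 2) := by
  have hn' : (0 : ℝ) < n := by exact_mod_cast hn
  let A : Fin (n + 1) → ℝ := Fin.cons a₀ fun j : Fin n => a j
  let B : Fin (n + 1) → ℝ := Fin.cons b₀ fun j : Fin n => b j
  have hA : ∀ i, 0 ≤ A i := fun i => by
    refine Fin.cases ?_ (fun j => ?_) i <;> simp [A, ha₀, ha]
  have hB : ∀ i, 0 ≤ B i := fun i => by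
    refine Fin.cases ?_ (fun j => ?_) i <;> simp [B, hb₀, hb]
  have h := integral_prod_sum_dirichletLaw_le (weightParam_nonneg hs n) (weightParam_le hs n) hn'
    (by rw [sum_weightParam]; linarith) (F := ![A, A, B, B]) (by
      intro k i
      fin_cases k
      exacts [hA i, hA i, hB i, hB i])
  simp only [Fin.prod_univ_four, Matrix.cons_val] at h
  convert h using 1
  · refine integral_congr_ae (ae_of_all _ fun w => ?_)
    simp only [weightedSum_eq, smul_eq_mul]
    ring
  · simp only [A, B, Fin.sum_univ_succ, Fin.cons_zero, Fin.cons_succ, Finset.sum_range]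
    push_cast
    ring

/-- Cut η at a level K. The bounded part leaves K² times the second moment for ξ; the tail part is
at most a constant times n⁻⁴(∑‖ξ_i‖)²(∑ tail)², small because the tail sum is at most δn. -/
theorem IsCentered.eventually_integral_norm_sq_mul_le {ξ : ℕ → H} {η : ℕ → H'}
    (hξ : IsCentered ξ) (hη : IsCentered η) {s : ℝ} (hs : 0 ≤ s) {ε : ℝ} (hε : 0 < ε) :
    ∀ᶠ n : ℕ in atTop, ∀ (ξ₀ : H) (η₀ : H'),
      ∫ w, ‖weightedSum w ξ₀ ξ‖ ^ 2 * ‖weightedSum w η₀ η‖ ^ 2 ∂dirichletLaw (weightParam s n)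
        ≤ ε * ((1 + ‖ξ₀‖ ^ 2) * (1 + ‖η₀‖ ^ 2)) := by
  obtain ⟨C, hC, hCn⟩ := hξ.tail.exists_sum_le
  -- The 8 collects three factors 2, from splitting η at K and from the two squared sums with the
  -- prior atom.
  set B : ℝ := 8 * (s + 5) ^ 4 * (1 + C ^ 2) with hB
  have hB0 : 0 < B := by positivity
  set δ := min 1 (ε / (2 * B)) with hδ
  have hδ0 : 0 < δ := by positivity
  have hδ1 : δ ≤ 1 := min_le_left _ _
  have hBδ : B * δ ≤ ε / 2 := by
    have : δ ≤ ε / (2 * B) := min_le_right _ _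
    rw [le_div_iff₀ (by positivity)] at this
    linarith
  obtain ⟨K, hK⟩ := hη.tail δ hδ0
  set ε₁ := ε / (4 * (K ^ 2 + 1)) with hε₁
  have hε₁0 : 0 < ε₁ := by positivity
  have hKε : 2 * (K : ℝ) ^ 2 * ε₁ ≤ ε / 2 := by
    rw [hε₁, mul_div_assoc', div_le_div_iff₀ (by positivity) (by positivity)]
    nlinarith [sq_nonneg (K : ℝ)]
  -- Makes δn ≥ 1, so that the atom ‖η₀‖ is absorbed into ‖η₀‖ δn.
  have hlarge : ∀ᶠ n : ℕ in atTop, 1 / δ ≤ (n : ℝ) :=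
    tendsto_natCast_atTop_atTop.eventually_ge_atTop _
  filter_upwards [hCn, hK, hξ.eventually_integral_norm_sq_le hs hε₁0, hlarge,
    eventually_gt_atTop 0] with n h1 h2 h3 h4 h0 ξ₀ η₀
  have hn : (0 : ℝ) < n := by exact_mod_cast h0
  have ha := weightParam_nonneg hs n
  let b : ℕ → ℝ := fun i => if (K : ℝ) < ‖η i‖ then ‖η i‖ else 0
  have hb : ∀ i, 0 ≤ b i := fun i => by
    simp only [b]
    split_ifs
    exacts [norm_nonneg _, le_rfl]
  have hpt : ∀ᵐ w ∂dirichletLaw (weightParam s n),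
      ‖weightedSum w ξ₀ ξ‖ ^ 2 * ‖weightedSum w η₀ η‖ ^ 2
        ≤ 2 * (K : ℝ) ^ 2 * ‖weightedSum w ξ₀ ξ‖ ^ 2
          + 2 * (weightedSum w ‖ξ₀‖ (fun i => ‖ξ i‖) ^ 2 * weightedSum w ‖η₀‖ b ^ 2) := by
    filter_upwards [ae_nonneg_dirichletLaw ha, ae_sum_le_one_dirichletLaw] with w hw hw1
    have hY : ‖weightedSum w η₀ η‖ ≤ K + weightedSum w ‖η₀‖ b := by
      refine (norm_weightedSum_le hw _ _).trans ?_
      simp only [weightedSum, smul_eq_mul]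
      rw [Fin.sum_univ_succ] at hw1
      have h5 : ∑ i : Fin n, w i.succ * ‖η i‖
          ≤ K * ∑ i : Fin n, w i.succ + ∑ i : Fin n, w i.succ * b i := by
        rw [Finset.mul_sum, ← Finset.sum_add_distrib]
        refine Finset.sum_le_sum fun i _ => ?_
        rw [mul_comm (K : ℝ), ← mul_add]
        refine mul_le_mul_of_nonneg_left ?_ (hw _)
        simp only [b]
        split_ifs with h
        · linarith [Nat.cast_nonneg (α := ℝ) K]
        · linarith [not_lt.1 h]
      have h6 : (K : ℝ) * ∑ i : Fin n, w i.succ ≤ K :=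
        mul_le_of_le_one_right (Nat.cast_nonneg K) (by linarith [hw 0])
      linarith
    have hX := norm_weightedSum_le hw ξ₀ ξ
    have hY2 : ‖weightedSum w η₀ η‖ ^ 2 ≤ 2 * (K : ℝ) ^ 2 + 2 * weightedSum w ‖η₀‖ b ^ 2 := by
      calc _ ≤ (K + weightedSum w ‖η₀‖ b) ^ 2 := by gcongr
        _ ≤ _ := by nlinarith [sq_nonneg (K - weightedSum w ‖η₀‖ b)]
    calc _ ≤ ‖weightedSum w ξ₀ ξ‖ ^ 2 * (2 * (K : ℝ) ^ 2 + 2 * weightedSum w ‖η₀‖ b ^ 2) := by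
          gcongr
      _ = 2 * (K : ℝ) ^ 2 * ‖weightedSum w ξ₀ ξ‖ ^ 2
          + 2 * (‖weightedSum w ξ₀ ξ‖ ^ 2 * weightedSum w ‖η₀‖ b ^ 2) := by ring
      _ ≤ _ := by gcongr
  have hi1 : Integrable (fun w : Fin (n + 1) → ℝ => 2 * (K : ℝ) ^ 2 * ‖weightedSum w ξ₀ ξ‖ ^ 2)
      (dirichletLaw (weightParam s n)) :=
    integrable_dirichletLaw ha (((continuous_weightedSum ξ₀ ξ).norm.pow 2).const_mul _)
  have hi2 : Integrable (fun w : Fin (n + 1) → ℝ =>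
      2 * (weightedSum w ‖ξ₀‖ (fun i => ‖ξ i‖) ^ 2 * weightedSum w ‖η₀‖ b ^ 2))
      (dirichletLaw (weightParam s n)) :=
    integrable_dirichletLaw ha ((((continuous_weightedSum _ _).pow 2).mul
      ((continuous_weightedSum _ _).pow 2)).const_mul _)
  refine (integral_mono_ae (integrable_dirichletLaw ha
    (((continuous_weightedSum ξ₀ ξ).norm.pow 2).mul ((continuous_weightedSum η₀ η).norm.pow 2)))
    (hi1.add hi2) hpt).trans ?_
  have hadd := integral_add hi1 hi2
  rw [integral_const_mul, integral_const_mul] at hadd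
  refine hadd.trans_le ?_
  have h7 := integral_weightedSum_sq_mul_sq_le hs h0 (norm_nonneg ξ₀) (norm_nonneg η₀)
    (a := fun i => ‖ξ i‖) (b := b) (fun i => norm_nonneg _) hb
  have hnδ : 1 ≤ δ * n := by
    have := (div_le_iff₀ hδ0).1 h4
    linarith
  have hn1 : (1 : ℝ) ≤ n := hnδ.trans (mul_le_of_le_one_left hn.le hδ1)
  have h8 : (‖ξ₀‖ + ∑ i ∈ Finset.range n, ‖ξ i‖) ^ 2
      ≤ 2 * ((1 + C ^ 2) * (1 + ‖ξ₀‖ ^ 2)) * (n : ℝ) ^ 2 := by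
    have h9 : 0 ≤ ∑ i ∈ Finset.range n, ‖ξ i‖ := Finset.sum_nonneg fun i _ => norm_nonneg _
    calc _ ≤ (‖ξ₀‖ * n + C * n) ^ 2 := by
          gcongr
          exact le_mul_of_one_le_right (norm_nonneg _) hn1
      _ = (‖ξ₀‖ + C) ^ 2 * (n : ℝ) ^ 2 := by ring
      _ ≤ _ := by
          gcongr
          nlinarith [sq_nonneg (‖ξ₀‖ - C), sq_nonneg (C * ‖ξ₀‖)]
  have h10 : (‖η₀‖ + ∑ i ∈ Finset.range n, b i) ^ 2
      ≤ 2 * (δ * (1 + ‖η₀‖ ^ 2)) * (n : ℝ) ^ 2 := by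
    have h9 : 0 ≤ ∑ i ∈ Finset.range n, b i := Finset.sum_nonneg fun i _ => hb i
    calc _ ≤ (‖η₀‖ * (δ * n) + δ * n) ^ 2 := by
          gcongr
          exact le_mul_of_one_le_right (norm_nonneg _) hnδ
      _ = (δ * δ) * (‖η₀‖ + 1) ^ 2 * (n : ℝ) ^ 2 := by ring
      _ ≤ (δ * 1) * (2 * (1 + ‖η₀‖ ^ 2)) * (n : ℝ) ^ 2 := by
          gcongr
          nlinarith [sq_nonneg (‖η₀‖ - 1)]
      _ = _ := by ring
  have h11 : ((s + 5) / n) ^ 4 * ((‖ξ₀‖ + ∑ i ∈ Finset.range n, ‖ξ i‖) ^ 2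
        * (‖η₀‖ + ∑ i ∈ Finset.range n, b i) ^ 2)
      ≤ B * δ / 2 * ((1 + ‖ξ₀‖ ^ 2) * (1 + ‖η₀‖ ^ 2)) := by
    calc _ ≤ ((s + 5) / n) ^ 4 * ((2 * ((1 + C ^ 2) * (1 + ‖ξ₀‖ ^ 2)) * (n : ℝ) ^ 2)
          * (2 * (δ * (1 + ‖η₀‖ ^ 2)) * (n : ℝ) ^ 2)) := by gcongr
      _ = _ := by
          rw [hB]
          field_simp
          ring
  have h12 : 2 * (K : ℝ) ^ 2 * ∫ w, ‖weightedSum w ξ₀ ξ‖ ^ 2 ∂dirichletLaw (weightParam s n)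
      ≤ 2 * (K : ℝ) ^ 2 * (ε₁ * (1 + ‖ξ₀‖ ^ 2)) := by
    gcongr
    exact h3 ξ₀
  have hx : (1 + ‖ξ₀‖ ^ 2) ≤ (1 + ‖ξ₀‖ ^ 2) * (1 + ‖η₀‖ ^ 2) :=
    le_mul_of_one_le_right (by positivity) (by linarith [sq_nonneg ‖η₀‖])
  have hxy : 0 ≤ (1 + ‖ξ₀‖ ^ 2) * (1 + ‖η₀‖ ^ 2) := by positivity
  have h13 : 2 * (K : ℝ) ^ 2 * (ε₁ * (1 + ‖ξ₀‖ ^ 2))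
      ≤ ε / 2 * ((1 + ‖ξ₀‖ ^ 2) * (1 + ‖η₀‖ ^ 2)) := by
    rw [← mul_assoc]
    exact mul_le_mul hKε hx (by positivity) (by positivity)
  have h14 := mul_le_mul_of_nonneg_right hBδ hxy
  linarith

end Weights

/-! ### Measurability of the criterion and of the posterior -/

section Measurability

variable {S : Type*} [MeasurableSpace S]

/-- The kernel that evaluates measures of mass at most one, and sends the others to zero. -/
def subprobKernel (S : Type*) [MeasurableSpace S] : Kernel (Measure S) S where
  toFun M := open Classical in if M Set.univ ≤ 1 then M else 0
  measurable' := Measurable.ite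
    (measurableSet_le (Measure.measurable_coe MeasurableSet.univ) measurable_const)
    measurable_id measurable_const

theorem subprobKernel_apply {M : Measure S} (hM : M Set.univ ≤ 1) : subprobKernel S M = M := by
  change (if M Set.univ ≤ 1 then M else 0) = M
  rw [if_pos hM]

instance : IsFiniteKernel (subprobKernel S) where
  exists_univ_le := by
    refine ⟨1, ENNReal.one_lt_top, fun M => ?_⟩
    change (if M Set.univ ≤ 1 then M else 0) Set.univ ≤ 1
    split_ifs with h
    · exact h
    · simp

/-- Integrals against a finite kernel depend measurably on its parameter; on measures of mass at
most one, `subprobKernel` is the identity. -/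
theorem aestronglyMeasurable_hsic {𝒳 𝒴 : Type*} [MeasurableSpace 𝒳] [MeasurableSpace 𝒴]
    {kX : 𝒳 → 𝒳 → ℝ} {kY : 𝒴 → 𝒴 → ℝ} (hkX : Measurable (Function.uncurry kX))
    (hkY : Measurable (Function.uncurry kY)) {ρ : Measure (Measure (𝒳 × 𝒴))}
    (hρ : ∀ᵐ M ∂ρ, M Set.univ ≤ 1) : AEStronglyMeasurable (hsic kX kY) ρ := by
  let κ := subprobKernel (𝒳 × 𝒴)
  have mX : Measurable fun p : (𝒳 × 𝒴) × (𝒳 × 𝒴) => kX p.1.1 p.2.1 :=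
    hkX.comp ((measurable_fst.comp measurable_fst).prodMk (measurable_fst.comp measurable_snd))
  have mY : Measurable fun p : (𝒳 × 𝒴) × (𝒳 × 𝒴) => kY p.1.2 p.2.2 :=
    hkY.comp ((measurable_snd.comp measurable_fst).prodMk (measurable_snd.comp measurable_snd))
  have hpair : ∀ {f : (𝒳 × 𝒴) × (𝒳 × 𝒴) → ℝ}, Measurable f →
      StronglyMeasurable fun M => ∫ p, f p ∂((κ M).prod (κ M)) := fun {f} hf => by
    have := StronglyMeasurable.integral_kernel (κ := κ ×ₖ κ) hf.stronglyMeasurable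
    simpa only [Kernel.prod_apply] using this
  have hone : ∀ {f : (𝒳 × 𝒴) × (𝒳 × 𝒴) → ℝ}, Measurable f →
      StronglyMeasurable fun q : Measure (𝒳 × 𝒴) × (𝒳 × 𝒴) => ∫ z', f (q.2, z') ∂(κ q.1) :=
    fun {f} hf => by
      have := StronglyMeasurable.integral_kernel_prod_right (κ := κ.prodMkRight (𝒳 × 𝒴))
        (f := fun q z' => f (q.2, z'))
        (hf.comp ((measurable_snd.comp measurable_fst).prodMk measurable_snd)).stronglyMeasurable
      simpa only [Kernel.prodMkRight_apply] using this
  have hthree : StronglyMeasurable fun M : Measure (𝒳 × 𝒴) =>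
      ∫ z, (∫ z', kX z.1 z'.1 ∂(κ M)) * (∫ z', kY z.2 z'.2 ∂(κ M)) ∂(κ M) :=
    StronglyMeasurable.integral_kernel_prod_right (κ := κ)
      (f := fun M z => (∫ z', kX z.1 z'.1 ∂(κ M)) * (∫ z', kY z.2 z'.2 ∂(κ M)))
      ((hone mX).mul (hone mY))
  have hκ : StronglyMeasurable fun M => hsic kX kY (κ M) :=
    ((hpair (mX.mul mY)).add ((hpair mX).mul (hpair mY))).sub (hthree.const_mul 2)
  refine ⟨_, hκ, ?_⟩
  filter_upwards [hρ] with M hM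
  rw [show κ M = M from subprobKernel_apply hM]

theorem measurable_mixture {n : ℕ} (z : Fin n → S) :
    Measurable fun p : (Fin (n + 1) → ℝ) × Measure S => mixture z p.1 p.2 := by
  refine Measure.measurable_of_measurable_coe _ fun B hB => ?_
  simp only [mixture, Measure.add_apply, Measure.smul_apply, Measure.finsetSum_apply, smul_eq_mul]
  have := (Measure.measurable_coe hB).comp
    (measurable_snd : Measurable (Prod.snd : (Fin (n + 1) → ℝ) × Measure S → Measure S))
  refine Measurable.add (Measurable.mul (by fun_prop) this) ?_
  fun_prop

theorem mixture_univ {n : ℕ} (z : Fin n → S) {w : Fin (n + 1) → ℝ} (hw : ∀ i, 0 ≤ w i)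
    (P₀ : Measure S) [IsProbabilityMeasure P₀] :
    mixture z w P₀ Set.univ = ENNReal.ofReal (∑ i, w i) := by
  rw [Fin.sum_univ_succ, ENNReal.ofReal_add (hw 0) (Finset.sum_nonneg fun i _ => hw _),
    ENNReal.ofReal_sum_of_nonneg fun i _ => hw _]
  simp [mixture]

theorem integrable_mixture {n : ℕ} (z : Fin n → S) (w : Fin (n + 1) → ℝ) {P₀ : Measure S}
    {f : S → ℝ} (hf : Measurable f) (hfP : Integrable f P₀) :
    Integrable f (mixture z w P₀) := by
  refine (hfP.smul_measure ENNReal.ofReal_ne_top).add_measure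
    (integrable_finsetSum_measure.2 fun i _ => ?_)
  exact (integrable_dirac' hf.stronglyMeasurable (by simp)).smul_measure ENNReal.ofReal_ne_top

/-- The mass is that of the weights. It can be 0 rather than 1: for s = 0 and n = 0 all weights
vanish. -/
theorem ae_posterior_univ_le_one {s : ℝ} (hs : 0 ≤ s) {Q : Measure (Measure S)} [SFinite Q]
    (hQ : ∀ᵐ M ∂Q, IsProbabilityMeasure M) {n : ℕ} (z : Fin n → S) :
    ∀ᵐ M ∂posterior s Q z, M Set.univ ≤ 1 := by
  have ha := weightParam_nonneg hs n
  have := isProbabilityMeasure_dirichletLaw ha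
  rw [posterior, ae_map_iff (measurable_mixture z).aemeasurable
    (measurableSet_le (Measure.measurable_coe MeasurableSet.univ) measurable_const)]
  filter_upwards [Measure.quasiMeasurePreserving_fst.ae (ae_nonneg_dirichletLaw ha),
    Measure.quasiMeasurePreserving_fst.ae (ae_sum_le_one_dirichletLaw (a := weightParam s n)),
    Measure.quasiMeasurePreserving_snd.ae hQ] with p h1 h2 h3
  rw [mixture_univ z h1]
  exact ENNReal.ofReal_le_one.2 h2

theorem isProbabilityMeasure_posterior {s : ℝ} (hs : 0 ≤ s) (Q : Measure (Measure S))
    [IsProbabilityMeasure Q] {n : ℕ} (z : Fin n → S) :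
    IsProbabilityMeasure (posterior s Q z) := by
  have := isProbabilityMeasure_dirichletLaw (weightParam_nonneg hs n)
  exact Measure.isProbabilityMeasure_map (μ := (dirichletLaw (weightParam s n)).prod Q)
    (measurable_mixture z).aemeasurable

/-- The Gamma variable of parameter 0 is 0, hence w 0 = 0 almost surely and the prior draw
disappears from the mixture. -/
theorem posterior_zero_eq (Q Q' : Measure (Measure S)) [IsProbabilityMeasure Q]
    [IsProbabilityMeasure Q'] {n : ℕ} (z : Fin n → S) : posterior 0 Q z = posterior 0 Q' z := by
  have ha := weightParam_nonneg le_rfl n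
  have := isProbabilityMeasure_dirichletLaw ha
  have hp : ∀ i, IsProbabilityMeasure (gammaLaw (weightParam 0 n i)) := fun i =>
    isProbabilityMeasure_gammaLaw (ha i)
  let g : (Fin (n + 1) → ℝ) → Measure S := fun w =>
    ∑ i : Fin n, ENNReal.ofReal (w i.succ) • Measure.dirac (z i)
  have hg : Measurable g := by
    refine Measure.measurable_of_measurable_coe _ fun B hB => ?_
    simp only [g, Measure.smul_apply, Measure.finsetSum_apply, smul_eq_mul]
    fun_prop
  have hw : ∀ᵐ w ∂dirichletLaw (weightParam 0 n), w 0 = 0 := by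
    rw [dirichletLaw, ae_map_iff measurable_normalize.aemeasurable
      (measurableSet_eq_fun (by fun_prop) measurable_const)]
    have h0 : ∀ᵐ x ∂gammaLaw (weightParam 0 n 0), x = 0 := by
      simp [gammaLaw, weightParam]
    have h1 : ∀ᵐ x ∂(Measure.pi fun i => gammaLaw (weightParam 0 n i)), x 0 = 0 :=
      (Measure.tendsto_eval_ae_ae (μ := fun i => gammaLaw (weightParam 0 n i))
        (i := 0)).eventually h0
    filter_upwards [h1] with x hx
    rw [hx, zero_div]
  have key : ∀ (R : Measure (Measure S)) [IsProbabilityMeasure R],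
      posterior 0 R z = (dirichletLaw (weightParam 0 n)).map g := by
    intro R _
    have h1 : posterior 0 R z
        = ((dirichletLaw (weightParam 0 n)).prod R).map fun p => g p.1 := by
      refine Measure.map_congr ?_
      filter_upwards [Measure.quasiMeasurePreserving_fst.ae hw] with p hp0
      simp [mixture, g, hp0]
    rw [h1, show (fun p : (Fin (n + 1) → ℝ) × Measure S => g p.1) = g ∘ Prod.fst from rfl,
      ← Measure.map_map hg measurable_fst, Measure.map_fst_prod]
    simp
  rw [key Q, key Q']

end Measurability

/-! ### Moment control of the prior draw -/

section Prior

theorem integrable_moment_integrand {S H : Type*} [MeasurableSpace S] [NormedAddCommGroup H]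
    {χ : S → H} {M : Measure S} [IsFiniteMeasure M]
    (h : Integrable (fun z => ‖χ z‖ ^ 2) M) (c : ℝ) :
    Integrable (fun z => 1 + 2 * ‖χ z‖ ^ 2 + 2 * c ^ 2) M :=
  ((integrable_const _).add (h.const_mul 2)).add (integrable_const _)

variable {S H H' : Type*} [MeasurableSpace S]
  [NormedAddCommGroup H] [InnerProductSpace ℝ H] [NormedAddCommGroup H'] [InnerProductSpace ℝ H']

/-- A probability measure for which both features and their tensor product are square
integrable. -/
structure HasSecondMoments (φ : S → H) (ψ : S → H') (M : Measure S) : Prop where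
  isProbabilityMeasure : IsProbabilityMeasure M
  left : Integrable (fun z => ‖φ z‖ ^ 2) M
  right : Integrable (fun z => ‖ψ z‖ ^ 2) M
  tensor : Integrable (fun z => ‖tensorFeature φ ψ z‖ ^ 2) M

/-- The integral of `1 + 2 * ‖χ‖ ^ 2 + 2 * c ^ 2`. -/
def moment (χ : S → H) (c : ℝ) (M : Measure S) : ENNReal :=
  ∫⁻ z, ENNReal.ofReal (1 + 2 * ‖χ z‖ ^ 2 + 2 * c ^ 2) ∂M

theorem IsFeature.measurable_moment_integrand {χ : S → H} (hχ : IsFeature χ) (c : ℝ) :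
    Measurable fun z => ENNReal.ofReal (1 + 2 * ‖χ z‖ ^ 2 + 2 * c ^ 2) := by
  have := hχ.measurable_norm
  fun_prop

theorem IsFeature.measurable_moment {χ : S → H} (hχ : IsFeature χ) (c : ℝ) :
    Measurable (moment χ c) :=
  Measure.measurable_lintegral (hχ.measurable_moment_integrand c)

theorem IsFeature.integrable_norm_of_sq {χ : S → H} (hχ : IsFeature χ) {M : Measure S}
    [IsFiniteMeasure M] (h : Integrable (fun z => ‖χ z‖ ^ 2) M) :
    Integrable (fun z => ‖χ z‖) M := by
  refine ((integrable_const (1 : ℝ)).add h).mono' hχ.measurable_norm.aestronglyMeasurable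
    (ae_of_all _ fun z => ?_)
  simp only [norm_norm, Pi.add_apply]
  nlinarith [sq_nonneg (‖χ z‖ - 1)]

/-- Jensen for the norm. The mean is chosen separately for each M, with no measurability in M;
`moment` is a majorant that is measurable. -/
theorem HasMean.ofReal_one_add_norm_sub_sq_le {χ : S → H} (hχ : IsFeature χ) {M : Measure S}
    [IsProbabilityMeasure M] (h : Integrable (fun z => ‖χ z‖ ^ 2) M) {m₀ : H}
    (hm₀ : HasMean χ M m₀) (m : H) :
    ENNReal.ofReal (1 + ‖m₀ - m‖ ^ 2) ≤ moment χ ‖m‖ M := by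
  have h1 := hχ.integrable_norm_of_sq h
  have h2 := hm₀.norm_le h1
  set c := ∫ z, ‖χ z‖ ∂M with hc
  have h3 : c ^ 2 ≤ ∫ z, ‖χ z‖ ^ 2 ∂M := by
    have h4 : 0 ≤ ∫ z, (‖χ z‖ ^ 2 - 2 * c * ‖χ z‖ + c ^ 2) ∂M :=
      integral_nonneg fun z => by
        have := sq_nonneg (‖χ z‖ - c)
        simp only [Pi.zero_apply]
        linarith
    have h5 : Integrable (fun z => ‖χ z‖ ^ 2 - 2 * c * ‖χ z‖) M := h.sub (h1.const_mul _)
    rw [integral_add h5 (integrable_const _), integral_sub h (h1.const_mul _),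
      integral_const_mul, ← hc] at h4
    simp only [integral_const, probReal_univ, one_smul] at h4
    nlinarith
  rw [moment, ← ofReal_integral_eq_lintegral_ofReal (integrable_moment_integrand h _)
    (ae_of_all _ fun z => by positivity)]
  refine ENNReal.ofReal_le_ofReal ?_
  have h4 : Integrable (fun z => 1 + 2 * ‖χ z‖ ^ 2) M :=
    (integrable_const _).add (h.const_mul 2)
  rw [integral_add h4 (integrable_const _), integral_add (integrable_const _) (h.const_mul 2),
    integral_const_mul]
  simp only [integral_const, probReal_univ, one_smul]
  have h5 : ‖m₀ - m‖ ^ 2 ≤ 2 * ‖m₀‖ ^ 2 + 2 * ‖m‖ ^ 2 := by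
    have := norm_sub_le m₀ m
    calc _ ≤ (‖m₀‖ + ‖m‖) ^ 2 := by gcongr
      _ ≤ _ := by nlinarith [sq_nonneg (‖m₀‖ - ‖m‖)]
  have h6 : ‖m₀‖ ^ 2 ≤ c ^ 2 := by gcongr
  linarith

/-- The moments of the prior component that control the criterion. -/
def priorMoment (φ : S → H) (ψ : S → H') (a b u : ℝ) (M : Measure S) : ENNReal :=
  moment φ a M * moment ψ b M + moment (tensorFeature φ ψ) u M

theorem SecondMomentBound.lintegral_lintegral_le {ν : Measure S} [IsProbabilityMeasure ν]
    {Q : Measure (Measure S)} (h : SecondMomentBound ν Q)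
    (hQ : ∀ᵐ M ∂Q, IsProbabilityMeasure M) {f : S → ENNReal} (hf : Measurable f) :
    ∫⁻ M, ∫⁻ z, f z ∂M ∂Q ≤ 2 * ∫⁻ z, f z ∂ν := by
  -- Testing with g = 1 gives ∫ f twice, whence the factor 2.
  have h1 := h f (fun _ => 1) hf measurable_const
  simp only [mul_one, lintegral_const, one_mul, measure_univ] at h1
  rw [two_mul]
  refine le_trans (le_of_eq (lintegral_congr_ae ?_)) h1
  filter_upwards [hQ] with M hM
  rw [measure_univ, mul_one]

/-- The product of moments is a mixed second moment. By `SecondMomentBound` it costs only integrals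
of ‖φ‖², ‖ψ‖² and ‖φ‖²‖ψ‖² under ν. -/
theorem lintegral_priorMoment_lt_top {φ : S → H} {ψ : S → H'} (hφ : IsFeature φ)
    (hψ : IsFeature ψ) {ν : Measure S} (hν : HasSecondMoments φ ψ ν) {Q : Measure (Measure S)}
    (h : SecondMomentBound ν Q) (hQ : ∀ᵐ M ∂Q, IsProbabilityMeasure M) (a b u : ℝ) :
    ∫⁻ M, priorMoment φ ψ a b u M ∂Q < ⊤ := by
  have := hν.isProbabilityMeasure
  have hΦ := hφ.tensor hψ
  unfold priorMoment
  rw [lintegral_add_right _ (hΦ.measurable_moment u)]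
  refine ENNReal.add_lt_top.2 ⟨?_, ?_⟩
  · refine (h _ _ (hφ.measurable_moment_integrand a) (hψ.measurable_moment_integrand b)).trans_lt
      (ENNReal.add_lt_top.2 ⟨?_, ENNReal.mul_lt_top ?_ ?_⟩)
    · have h1 : ∀ z, ENNReal.ofReal (1 + 2 * ‖φ z‖ ^ 2 + 2 * a ^ 2)
            * ENNReal.ofReal (1 + 2 * ‖ψ z‖ ^ 2 + 2 * b ^ 2)
          = ENNReal.ofReal ((1 + 2 * a ^ 2) * (1 + 2 * b ^ 2)
            + 2 * (1 + 2 * b ^ 2) * ‖φ z‖ ^ 2 + 2 * (1 + 2 * a ^ 2) * ‖ψ z‖ ^ 2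
            + 4 * ‖tensorFeature φ ψ z‖ ^ 2) := fun z => by
        rw [← ENNReal.ofReal_mul (by positivity), norm_tensorFeature]
        congr 1
        ring
      simp_rw [h1]
      exact ((((integrable_const _).add (hν.left.const_mul _)).add (hν.right.const_mul _)).add
        (hν.tensor.const_mul _)).lintegral_lt_top
    · exact (integrable_moment_integrand hν.left a).lintegral_lt_top
    · exact (integrable_moment_integrand hν.right b).lintegral_lt_top
  · refine (h.lintegral_lintegral_le hQ (hΦ.measurable_moment_integrand u)).trans_lt ?_
    exact ENNReal.mul_lt_top (by simp) (integrable_moment_integrand hν.tensor u).lintegral_lt_top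

theorem ae_integrable_norm_sq {χ : S → H} (hχ : IsFeature χ) {ν : Measure S}
    [IsProbabilityMeasure ν] {Q : Measure (Measure S)} (h : SecondMomentBound ν Q)
    (hQ : ∀ᵐ M ∂Q, IsProbabilityMeasure M) (hν : Integrable (fun z => ‖χ z‖ ^ 2) ν) :
    ∀ᵐ M ∂Q, Integrable (fun z => ‖χ z‖ ^ 2) M := by
  have hm : Measurable fun z => ‖χ z‖ ^ 2 := hχ.measurable_norm.pow_const 2
  have h1 : ∫⁻ M, ∫⁻ z, ENNReal.ofReal (‖χ z‖ ^ 2) ∂M ∂Q ≠ ⊤ :=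
    ((h.lintegral_lintegral_le hQ hm.ennreal_ofReal).trans_lt
      (ENNReal.mul_lt_top (by simp) hν.lintegral_lt_top)).ne
  filter_upwards [ae_lt_top (Measure.measurable_lintegral hm.ennreal_ofReal) h1] with M hM
  refine ⟨hm.aestronglyMeasurable, ?_⟩
  rw [hasFiniteIntegral_iff_ofReal (ae_of_all _ fun z => by positivity)]
  exact hM

theorem ae_hasSecondMoments {φ : S → H} {ψ : S → H'} (hφ : IsFeature φ) (hψ : IsFeature ψ)
    {ν : Measure S} (hν : HasSecondMoments φ ψ ν) {Q : Measure (Measure S)}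
    (h : SecondMomentBound ν Q) (hQ : ∀ᵐ M ∂Q, IsProbabilityMeasure M) :
    ∀ᵐ M ∂Q, HasSecondMoments φ ψ M := by
  have := hν.isProbabilityMeasure
  filter_upwards [hQ, ae_integrable_norm_sq hφ h hQ hν.left,
    ae_integrable_norm_sq hψ h hQ hν.right,
    ae_integrable_norm_sq (hφ.tensor hψ) h hQ hν.tensor] with M h1 h2 h3 h4
  exact ⟨h1, h2, h3, h4⟩

theorem HasSecondMoments.ofReal_le_priorMoment {φ : S → H} {ψ : S → H'} (hφ : IsFeature φ)
    (hψ : IsFeature ψ) {M : Measure S} (hM : HasSecondMoments φ ψ M) {a₀ a : H} {b₀ b : H'}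
    {u₀ u : UniformSpace.Completion (H ⊗[ℝ] H')} (ha : HasMean φ M a₀) (hb : HasMean ψ M b₀)
    (hu : HasMean (tensorFeature φ ψ) M u₀) :
    ENNReal.ofReal ((1 + ‖a₀ - a‖ ^ 2) * (1 + ‖b₀ - b‖ ^ 2) + (1 + ‖u₀ - u‖ ^ 2))
      ≤ priorMoment φ ψ ‖a‖ ‖b‖ ‖u‖ M := by
  have := hM.isProbabilityMeasure
  rw [ENNReal.ofReal_add (by positivity) (by positivity), ENNReal.ofReal_mul (by positivity)]
  exact add_le_add (mul_le_mul' (ha.ofReal_one_add_norm_sub_sq_le hφ hM.left a)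
    (hb.ofReal_one_add_norm_sub_sq_le hψ hM.right b))
    (hu.ofReal_one_add_norm_sub_sq_le (hφ.tensor hψ) hM.tensor u)

end Prior

/-! ### Stability of ‖u - a ⊗ b‖² -/

section Perturbation

variable {H H' : Type*} [NormedAddCommGroup H] [InnerProductSpace ℝ H] [NormedAddCommGroup H']
  [InnerProductSpace ℝ H']

/-- The covariance part `u - a ⊗ b` of a joint mean. -/
def covPart (u : UniformSpace.Completion (H ⊗[ℝ] H')) (a : H) (b : H') :
    UniformSpace.Completion (H ⊗[ℝ] H') :=
  u - ((a ⊗ₜ[ℝ] b : H ⊗[ℝ] H') : UniformSpace.Completion (H ⊗[ℝ] H'))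

theorem norm_covPart_sub_le (u u' : UniformSpace.Completion (H ⊗[ℝ] H')) (a a' : H) (b b' : H') :
    ‖covPart u' a' b' - covPart u a b‖
      ≤ ‖u' - u‖ + ‖a' - a‖ * ‖b‖ + ‖a‖ * ‖b' - b‖ + ‖a' - a‖ * ‖b' - b‖ := by
  have h : covPart u' a' b' - covPart u a b = (u' - u)
      - ((((a' - a) ⊗ₜ[ℝ] b + a ⊗ₜ[ℝ] (b' - b) + (a' - a) ⊗ₜ[ℝ] (b' - b) : H ⊗[ℝ] H')) :
        UniformSpace.Completion (H ⊗[ℝ] H')) := by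
    have h1 : (a' - a) ⊗ₜ[ℝ] b + a ⊗ₜ[ℝ] (b' - b) + (a' - a) ⊗ₜ[ℝ] (b' - b)
        = a' ⊗ₜ[ℝ] b' - a ⊗ₜ[ℝ] b := by
      simp only [TensorProduct.sub_tmul, TensorProduct.tmul_sub]
      abel
    rw [h1, UniformSpace.Completion.coe_sub, covPart, covPart]
    abel
  rw [h]
  refine (norm_sub_le _ _).trans ?_
  rw [UniformSpace.Completion.norm_coe]
  have h2 := norm_add₃_le (a := (a' - a) ⊗ₜ[ℝ] b) (b := a ⊗ₜ[ℝ] (b' - b))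
    (c := (a' - a) ⊗ₜ[ℝ] (b' - b))
  simp only [TensorProduct.norm_tmul] at h2
  linarith

theorem abs_norm_sq_sub_norm_sq_le {E : Type*} [SeminormedAddCommGroup E] (x y : E) :
    |‖y‖ ^ 2 - ‖x‖ ^ 2| ≤ ‖y - x‖ ^ 2 + 2 * ‖x‖ * ‖y - x‖ := by
  have h1 := abs_norm_sub_norm_le y x
  have h2 : |‖y‖ + ‖x‖| ≤ ‖y - x‖ + 2 * ‖x‖ := by
    rw [abs_of_nonneg (by positivity)]
    have := norm_le_norm_sub_add y x
    linarith
  calc |‖y‖ ^ 2 - ‖x‖ ^ 2| = |‖y‖ - ‖x‖| * |‖y‖ + ‖x‖| := by rw [← abs_mul]; ring_nf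
    _ ≤ ‖y - x‖ * (‖y - x‖ + 2 * ‖x‖) := mul_le_mul h1 h2 (abs_nonneg _) (norm_nonneg _)
    _ = _ := by ring

/-- Young's inequality with parameter t removes the linear term, leaving only squared deviations and
their product, whose Dirichlet expectations are under control. -/
theorem abs_norm_covPart_sq_sub_le (u u' : UniformSpace.Completion (H ⊗[ℝ] H')) (a a' : H)
    (b b' : H') {t : ℝ} (ht : 0 < t) :
    |‖covPart u' a' b'‖ ^ 2 - ‖covPart u a b‖ ^ 2|
      ≤ t * ‖covPart u a b‖ ^ 2 + 4 * (1 + 1 / t) * (‖u' - u‖ ^ 2 + ‖b‖ ^ 2 * ‖a' - a‖ ^ 2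
        + ‖a‖ ^ 2 * ‖b' - b‖ ^ 2 + ‖a' - a‖ ^ 2 * ‖b' - b‖ ^ 2) := by
  set e := ‖covPart u' a' b' - covPart u a b‖
  set x := ‖covPart u a b‖
  have h1 : |‖covPart u' a' b'‖ ^ 2 - x ^ 2| ≤ e ^ 2 + 2 * x * e :=
    abs_norm_sq_sub_norm_sq_le _ _
  have h2 : 2 * x * e ≤ t * x ^ 2 + 1 / t * e ^ 2 := by
    have h3 := sq_nonneg (t * x - e)
    have h4 : t * x ^ 2 + 1 / t * e ^ 2 - 2 * x * e = 1 / t * (t * x - e) ^ 2 := by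
      field_simp
      ring
    have : 0 ≤ 1 / t * (t * x - e) ^ 2 := by positivity
    linarith
  have h5 : e ^ 2 ≤ 4 * (‖u' - u‖ ^ 2 + ‖b‖ ^ 2 * ‖a' - a‖ ^ 2
        + ‖a‖ ^ 2 * ‖b' - b‖ ^ 2 + ‖a' - a‖ ^ 2 * ‖b' - b‖ ^ 2) := by
    have h6 : e ^ 2 ≤ (‖u' - u‖ + ‖a' - a‖ * ‖b‖ + ‖a‖ * ‖b' - b‖ + ‖a' - a‖ * ‖b' - b‖) ^ 2 := by
      have := norm_covPart_sub_le u u' a a' b b'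
      gcongr
    refine h6.trans ?_
    generalize ‖u' - u‖ = p
    generalize hq : ‖a' - a‖ * ‖b‖ = q
    generalize hr : ‖a‖ * ‖b' - b‖ = r
    generalize hv : ‖a' - a‖ * ‖b' - b‖ = v
    have hq' : ‖b‖ ^ 2 * ‖a' - a‖ ^ 2 = q ^ 2 := by rw [← hq]; ring
    have hr' : ‖a‖ ^ 2 * ‖b' - b‖ ^ 2 = r ^ 2 := by rw [← hr]; ring
    have hv' : ‖a' - a‖ ^ 2 * ‖b' - b‖ ^ 2 = v ^ 2 := by rw [← hv]; ring
    rw [hq', hr', hv']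
    nlinarith [sq_nonneg (p - q), sq_nonneg (p - r), sq_nonneg (p - v), sq_nonneg (q - r),
      sq_nonneg (q - v), sq_nonneg (r - v)]
  have h7 : 1 / t * e ^ 2 ≤ 1 / t * (4 * (‖u' - u‖ ^ 2 + ‖b‖ ^ 2 * ‖a' - a‖ ^ 2
        + ‖a‖ ^ 2 * ‖b' - b‖ ^ 2 + ‖a' - a‖ ^ 2 * ‖b' - b‖ ^ 2)) := by gcongr
  linarith

theorem tendsto_norm_covPart_sq {ι : Type*} {l : Filter ι}
    {u : UniformSpace.Completion (H ⊗[ℝ] H')} {a : H} {b : H'}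
    {u' : ι → UniformSpace.Completion (H ⊗[ℝ] H')} {a' : ι → H} {b' : ι → H'}
    (hu : Tendsto u' l (𝓝 u)) (ha : Tendsto a' l (𝓝 a)) (hb : Tendsto b' l (𝓝 b)) :
    Tendsto (fun i => ‖covPart (u' i) (a' i) (b' i)‖ ^ 2) l (𝓝 (‖covPart u a b‖ ^ 2)) := by
  rw [tendsto_iff_norm_sub_tendsto_zero] at hu ha hb
  have h : Tendsto (fun i => covPart (u' i) (a' i) (b' i)) l (𝓝 (covPart u a b)) := by
    rw [tendsto_iff_norm_sub_tendsto_zero]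
    refine squeeze_zero (fun i => norm_nonneg _) (fun i => norm_covPart_sub_le _ _ _ _ _ _) ?_
    simpa using ((hu.add (ha.mul_const ‖b‖)).add (hb.const_mul ‖a‖)).add (ha.mul hb)
  exact h.norm.pow 2

end Perturbation

/-! ### L¹ convergence of the criterion under the posterior -/

section Posterior

variable {𝒳 𝒴 H H' : Type*} [MeasurableSpace 𝒳] [MeasurableSpace 𝒴]
  [NormedAddCommGroup H] [InnerProductSpace ℝ H] [NormedAddCommGroup H'] [InnerProductSpace ℝ H']
  {kX : 𝒳 → 𝒳 → ℝ} {kY : 𝒴 → 𝒴 → ℝ} {φ : 𝒳 × 𝒴 → H} {ψ : 𝒳 × 𝒴 → H'}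

/-- Feature maps of two kernels, as functions on the product space. -/
structure IsFeaturePair (kX : 𝒳 → 𝒳 → ℝ) (kY : 𝒴 → 𝒴 → ℝ) (φ : 𝒳 × 𝒴 → H)
    (ψ : 𝒳 × 𝒴 → H') : Prop where
  left : IsFeature φ
  right : IsFeature ψ
  inner_left : ∀ z z', inner ℝ (φ z) (φ z') = kX z.1 z'.1
  inner_right : ∀ z z', inner ℝ (ψ z) (ψ z') = kY z.2 z'.2

/-- Tonelli: average over the weights with the prior draw fixed, then over the draw. -/
theorem lintegral_posterior_le (hkX : Measurable (Function.uncurry kX))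
    (hkY : Measurable (Function.uncurry kY)) {s : ℝ} (hs : 0 ≤ s)
    {Q : Measure (Measure (𝒳 × 𝒴))} [SFinite Q]
    (hQ : ∀ᵐ M ∂Q, IsProbabilityMeasure M) {n : ℕ} (z : Fin n → 𝒳 × 𝒴) (c : ℝ)
    {G : Measure (𝒳 × 𝒴) → ENNReal} (hG : Measurable G) (K : ENNReal)
    (h : ∀ᵐ P₀ ∂Q, ∫⁻ w, ‖hsic kX kY (mixture z w P₀) - c‖ₑ ∂dirichletLaw (weightParam s n)
      ≤ K * G P₀) :
    ∫⁻ M, ‖hsic kX kY M - c‖ₑ ∂posterior s Q z ≤ K * ∫⁻ M, G M ∂Q := by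
  have := isProbabilityMeasure_dirichletLaw (weightParam_nonneg hs n)
  have hm : AEMeasurable (fun M => ‖hsic kX kY M - c‖ₑ) (posterior s Q z) :=
    ((aestronglyMeasurable_hsic hkX hkY
      (ae_posterior_univ_le_one hs hQ z)).sub aestronglyMeasurable_const).enorm
  have hmix := (measurable_mixture z).aemeasurable (μ := (dirichletLaw (weightParam s n)).prod Q)
  calc ∫⁻ M, ‖hsic kX kY M - c‖ₑ ∂posterior s Q z
      = ∫⁻ p, ‖hsic kX kY (mixture z p.1 p.2) - c‖ₑ ∂((dirichletLaw (weightParam s n)).prod Q) :=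
        lintegral_map' hm hmix
    _ = ∫⁻ P₀, ∫⁻ w, ‖hsic kX kY (mixture z w P₀) - c‖ₑ ∂dirichletLaw (weightParam s n) ∂Q :=
        lintegral_prod_symm _ (hm.comp_aemeasurable hmix)
    _ ≤ ∫⁻ P₀, K * G P₀ ∂Q := lintegral_mono_ae h
    _ = _ := lintegral_const_mul _ hG

theorem IsFeaturePair.hsic_mixture (hp : IsFeaturePair kX kY φ ψ) {P₀ : Measure (𝒳 × 𝒴)}
    (hP₀ : HasSecondMoments φ ψ P₀) {a₀ : H} {b₀ : H'}
    {u₀ : UniformSpace.Completion (H ⊗[ℝ] H')} (ha : HasMean φ P₀ a₀) (hb : HasMean ψ P₀ b₀)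
    (hu : HasMean (tensorFeature φ ψ) P₀ u₀) (z : ℕ → 𝒳 × 𝒴) {n : ℕ} {w : Fin (n + 1) → ℝ}
    (hw : ∀ i, 0 ≤ w i) :
    hsic kX kY (mixture (fun i : Fin n => z i) w P₀)
      = ‖covPart (weightedSum w u₀ fun i => tensorFeature φ ψ (z i))
        (weightedSum w a₀ fun i => φ (z i)) (weightedSum w b₀ fun i => ψ (z i))‖ ^ 2 := by
  have := hP₀.isProbabilityMeasure
  have hfin : IsFiniteMeasure (mixture (fun i : Fin n => z i) w P₀) :=
    ⟨by rw [mixture_univ _ hw]; exact ENNReal.ofReal_lt_top⟩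
  have hΦ := hp.left.tensor hp.right
  refine hsic_eq_norm_sq hp.left hp.right hp.inner_left hp.inner_right
    (integrable_mixture _ _ hp.left.measurable_norm (hp.left.integrable_norm_of_sq hP₀.left))
    (integrable_mixture _ _ hp.right.measurable_norm (hp.right.integrable_norm_of_sq hP₀.right))
    ?_ (hp.left.hasMean_mixture _ hw ha) (hp.right.hasMean_mixture _ hw hb)
    (hΦ.hasMean_mixture _ hw hu)
  have := integrable_mixture (fun i : Fin n => z i) w hΦ.measurable_norm
    (hΦ.integrable_norm_of_sq hP₀.tensor)
  simpa only [norm_tensorFeature] using this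

/-- Weights of total mass one commute with recentring; thus deviations become weighted sums of
centred terms. -/
theorem weightedSum_sub {n : ℕ} {w : Fin (n + 1) → ℝ} (hw : ∑ i, w i = 1) (ξ₀ m : H)
    (ξ : ℕ → H) : weightedSum w ξ₀ ξ - m = weightedSum w (ξ₀ - m) fun i => ξ i - m := by
  rw [Fin.sum_univ_succ] at hw
  simp only [weightedSum, smul_sub, Finset.sum_sub_distrib, ← Finset.sum_smul]
  have : m = w 0 • m + (∑ i : Fin n, w i.succ) • m := by rw [← add_smul, hw, one_smul]
  nth_rewrite 1 [this]
  abel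

theorem norm_weightedSum_sq_le {n : ℕ} {w : Fin (n + 1) → ℝ} (hw : ∀ i, 0 ≤ w i)
    (hw1 : ∑ i, w i ≤ 1) (ξ₀ : H) (ξ : ℕ → H) :
    ‖weightedSum w ξ₀ ξ‖ ^ 2
      ≤ (1 + (∑ i ∈ Finset.range n, ‖ξ i‖) ^ 2) * (1 + ‖ξ₀‖ ^ 2) := by
  have hle : ∀ i, w i ≤ 1 := fun i =>
    (Finset.single_le_sum (fun j _ => hw j) (Finset.mem_univ i)).trans hw1
  have h1 : ‖weightedSum w ξ₀ ξ‖ ≤ ‖ξ₀‖ + ∑ i ∈ Finset.range n, ‖ξ i‖ := by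
    refine (norm_weightedSum_le hw _ _).trans ?_
    rw [Finset.sum_range]
    exact add_le_add (mul_le_of_le_one_left (norm_nonneg _) (hle _))
      (Finset.sum_le_sum fun i _ => mul_le_of_le_one_left (norm_nonneg _) (hle _))
  calc _ ≤ (‖ξ₀‖ + ∑ i ∈ Finset.range n, ‖ξ i‖) ^ 2 := by gcongr
    _ ≤ _ := by nlinarith [sq_nonneg (‖ξ₀‖ * (∑ i ∈ Finset.range n, ‖ξ i‖) - 1)]

theorem IsFeaturePair.measurable_priorMoment (hp : IsFeaturePair kX kY φ ψ) (a b u : ℝ) :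
    Measurable (priorMoment φ ψ a b u) :=
  ((hp.left.measurable_moment a).mul (hp.right.measurable_moment b)).add
    ((hp.left.tensor hp.right).measurable_moment u)

theorem IsCentered.tendsto_average {x : ℕ → H} {m : H} (h : IsCentered fun i => x i - m) :
    Tendsto (fun n : ℕ => (n : ℝ)⁻¹ • ∑ i : Fin n, x i) atTop (𝓝 m) := by
  rw [tendsto_iff_norm_sub_tendsto_zero]
  refine h.average.congr' ?_
  filter_upwards [eventually_gt_atTop 0] with n hn
  have hn' : (n : ℝ) ≠ 0 := by positivity
  have e : (n : ℝ)⁻¹ • ∑ i : Fin n, x i - m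
      = (n : ℝ)⁻¹ • ∑ i ∈ Finset.range n, (x i - m) := by
    rw [Finset.sum_sub_distrib, smul_sub, Finset.sum_range]
    simp [← Nat.cast_smul_eq_nsmul ℝ, smul_smul, hn']
  rw [e, norm_smul, norm_inv, Real.norm_natCast, div_eq_inv_mul]

theorem IsFeaturePair.tendsto_hsicObs (hp : IsFeaturePair kX kY φ ψ) {z : ℕ → 𝒳 × 𝒴} {a : H}
    {b : H'} {u : UniformSpace.Completion (H ⊗[ℝ] H')} (ha : IsCentered fun i => φ (z i) - a)
    (hb : IsCentered fun i => ψ (z i) - b)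
    (hu : IsCentered fun i => tensorFeature φ ψ (z i) - u) :
    Tendsto (fun n : ℕ => hsicObs kX kY fun i : Fin n => z i) atTop
      (𝓝 (‖covPart u a b‖ ^ 2)) := by
  simp_rw [hsicObs_eq_norm_sq hp.inner_left hp.inner_right]
  exact tendsto_norm_covPart_sq hu.tendsto_average ha.tendsto_average hb.tendsto_average

variable [CompleteSpace H] [CompleteSpace H']

theorem HasSecondMoments.exists_means (hp : IsFeaturePair kX kY φ ψ) {M : Measure (𝒳 × 𝒴)}
    (hM : HasSecondMoments φ ψ M) :
    (∃ a, HasMean φ M a) ∧ (∃ b, HasMean ψ M b) ∧ ∃ u, HasMean (tensorFeature φ ψ) M u := by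
  have := hM.isProbabilityMeasure
  have hΦ := hp.left.tensor hp.right
  exact ⟨hp.left.exists_hasMean (hp.left.integrable_norm_of_sq hM.left),
    hp.right.exists_hasMean (hp.right.integrable_norm_of_sq hM.right),
    hΦ.exists_hasMean (hΦ.integrable_norm_of_sq hM.tensor)⟩

/-- With n fixed the crude bound w_i ≤ 1 is enough. It does not need the weights to sum to one, so n
= 0 is covered for s = 0 too. -/
theorem IsFeaturePair.integrable_hsic_posterior (hp : IsFeaturePair kX kY φ ψ)
    (hkX : Measurable (Function.uncurry kX)) (hkY : Measurable (Function.uncurry kY))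
    {s : ℝ} (hs : 0 ≤ s) {ν : Measure (𝒳 × 𝒴)} (hν : HasSecondMoments φ ψ ν)
    {Q : Measure (Measure (𝒳 × 𝒴))} [IsProbabilityMeasure Q] (hQν : SecondMomentBound ν Q)
    (hQ : ∀ᵐ M ∂Q, IsProbabilityMeasure M) (z : ℕ → 𝒳 × 𝒴) (n : ℕ) :
    Integrable (hsic kX kY) (posterior s Q fun i : Fin n => z i) := by
  refine ⟨aestronglyMeasurable_hsic hkX hkY (ae_posterior_univ_le_one hs hQ _), ?_⟩
  have ha := weightParam_nonneg hs n
  have := isProbabilityMeasure_dirichletLaw ha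
  let A := 1 + (∑ i ∈ Finset.range n, ‖φ (z i)‖) ^ 2
  let B := 1 + (∑ i ∈ Finset.range n, ‖ψ (z i)‖) ^ 2
  let U := 1 + (∑ i ∈ Finset.range n, ‖tensorFeature φ ψ (z i)‖) ^ 2
  have hbound := lintegral_posterior_le hkX hkY hs hQ (fun i : Fin n => z i) 0
    (hp.measurable_priorMoment 0 0 0) (ENNReal.ofReal (2 * (U + A * B))) (by
      filter_upwards [ae_hasSecondMoments hp.left hp.right hν hQν hQ] with P₀ hP₀
      obtain ⟨⟨a₀, ha₀⟩, ⟨b₀, hb₀⟩, ⟨u₀, hu₀⟩⟩ := hP₀.exists_means hp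
      have hprior := hP₀.ofReal_le_priorMoment hp.left hp.right ha₀ hb₀ hu₀ (a := 0) (b := 0)
        (u := 0)
      simp only [sub_zero, norm_zero] at hprior
      refine le_trans ?_ (mul_le_mul' le_rfl hprior)
      rw [← ENNReal.ofReal_mul (by positivity)]
      refine (lintegral_mono_ae (g := fun _ => ENNReal.ofReal (2 * (U + A * B)
        * ((1 + ‖a₀‖ ^ 2) * (1 + ‖b₀‖ ^ 2) + (1 + ‖u₀‖ ^ 2)))) ?_).trans_eq (by simp)
      filter_upwards [ae_nonneg_dirichletLaw ha, ae_sum_le_one_dirichletLaw] with w hw hw1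
      rw [sub_zero, hp.hsic_mixture hP₀ ha₀ hb₀ hu₀ z hw,
        Real.enorm_of_nonneg (by positivity)]
      refine ENNReal.ofReal_le_ofReal ?_
      have h1 := norm_weightedSum_sq_le hw hw1 a₀ fun i => φ (z i)
      have h2 := norm_weightedSum_sq_le hw hw1 b₀ fun i => ψ (z i)
      have h3 := norm_weightedSum_sq_le hw hw1 u₀ fun i => tensorFeature φ ψ (z i)
      generalize weightedSum w a₀ (fun i => φ (z i)) = a at h1 ⊢
      generalize weightedSum w b₀ (fun i => ψ (z i)) = b at h2 ⊢
      generalize weightedSum w u₀ (fun i => tensorFeature φ ψ (z i)) = u at h3 ⊢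
      have h4 : ‖covPart u a b‖ ≤ ‖u‖ + ‖a‖ * ‖b‖ := by
        refine (norm_sub_le _ _).trans_eq ?_
        rw [UniformSpace.Completion.norm_coe, TensorProduct.norm_tmul]
      have h5 : ‖a‖ ^ 2 * ‖b‖ ^ 2 ≤ (A * (1 + ‖a₀‖ ^ 2)) * (B * (1 + ‖b₀‖ ^ 2)) :=
        mul_le_mul h1 h2 (by positivity) (by positivity)
      have hA : 0 ≤ A := by positivity
      have hB : 0 ≤ B := by positivity
      have hU : 0 ≤ U := by positivity
      calc ‖covPart u a b‖ ^ 2 ≤ (‖u‖ + ‖a‖ * ‖b‖) ^ 2 := by gcongr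
        _ ≤ 2 * ‖u‖ ^ 2 + 2 * (‖a‖ ^ 2 * ‖b‖ ^ 2) := by
            nlinarith [sq_nonneg (‖u‖ - ‖a‖ * ‖b‖)]
        _ ≤ 2 * (U * (1 + ‖u₀‖ ^ 2))
            + 2 * ((A * (1 + ‖a₀‖ ^ 2)) * (B * (1 + ‖b₀‖ ^ 2))) := by gcongr
        _ ≤ _ := by
            have h6 : 0 ≤ U * ((1 + ‖a₀‖ ^ 2) * (1 + ‖b₀‖ ^ 2)) := by positivity
            have h7 : 0 ≤ A * B * (1 + ‖u₀‖ ^ 2) := by positivity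
            linarith)
  simp only [sub_zero] at hbound
  exact hbound.trans_lt (ENNReal.mul_lt_top ENNReal.ofReal_lt_top
    (lintegral_priorMoment_lt_top hp.left hp.right hν hQν hQ 0 0 0))

theorem IsFeaturePair.tendsto_lintegral_posterior (hp : IsFeaturePair kX kY φ ψ)
    (hkX : Measurable (Function.uncurry kX)) (hkY : Measurable (Function.uncurry kY))
    {s : ℝ} (hs : 0 ≤ s) {ν : Measure (𝒳 × 𝒴)} (hν : HasSecondMoments φ ψ ν)
    {Q : Measure (Measure (𝒳 × 𝒴))} [IsProbabilityMeasure Q] (hQν : SecondMomentBound ν Q)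
    (hQ : ∀ᵐ M ∂Q, IsProbabilityMeasure M) {z : ℕ → 𝒳 × 𝒴} {a : H} {b : H'}
    {u : UniformSpace.Completion (H ⊗[ℝ] H')} (ha : IsCentered fun i => φ (z i) - a)
    (hb : IsCentered fun i => ψ (z i) - b)
    (hu : IsCentered fun i => tensorFeature φ ψ (z i) - u) :
    Tendsto (fun n : ℕ => ∫⁻ M, ‖hsic kX kY M - ‖covPart u a b‖ ^ 2‖ₑ
      ∂(posterior s Q fun i : Fin n => z i)) atTop (𝓝 0) := by
  have hfin := (lintegral_priorMoment_lt_top hp.left hp.right hν hQν hQ ‖a‖ ‖b‖ ‖u‖).ne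
  set T := ∫⁻ M, priorMoment φ ψ ‖a‖ ‖b‖ ‖u‖ M ∂Q with hT
  have key : ∀ ε : ℝ, 0 < ε → ∀ᶠ n : ℕ in atTop,
      ∫⁻ M, ‖hsic kX kY M - ‖covPart u a b‖ ^ 2‖ₑ ∂(posterior s Q fun i : Fin n => z i)
        ≤ ENNReal.ofReal ε * T := by
    intro ε hε
    set X := ‖covPart u a b‖ ^ 2 with hX
    have hX0 : 0 ≤ X := by positivity
    -- Half of ε pays for the Young term tX; δ below is chosen so that all the deviation terms share
    -- the other half.
    set t := ε / (2 * (X + 1)) with ht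
    have ht0 : 0 < t := by positivity
    have htX : t * X ≤ ε / 2 := by
      rw [ht, div_mul_eq_mul_div, div_le_div_iff₀ (by positivity) (by positivity)]
      nlinarith
    set L := 4 * (1 + 1 / t) with hL
    have hL0 : 0 < L := by positivity
    set δ := ε / (2 * (L * (1 + ‖a‖ ^ 2 + ‖b‖ ^ 2))) with hδ
    have hδ0 : 0 < δ := by positivity
    have hδL : L * (δ * (1 + ‖a‖ ^ 2 + ‖b‖ ^ 2)) = ε / 2 := by
      rw [hδ]
      field_simp
    filter_upwards [ha.eventually_integral_norm_sq_le hs hδ0,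
      hb.eventually_integral_norm_sq_le hs hδ0, hu.eventually_integral_norm_sq_le hs hδ0,
      ha.eventually_integral_norm_sq_mul_le hb hs hδ0, eventually_gt_atTop 0] with n h1 h2 h3 h4 hn
    have hn' : (0 : ℝ) < n := by exact_mod_cast hn
    have hw0 := weightParam_nonneg hs n
    have := isProbabilityMeasure_dirichletLaw hw0
    refine lintegral_posterior_le hkX hkY hs hQ _ _ (hp.measurable_priorMoment _ _ _) _ ?_
    filter_upwards [ae_hasSecondMoments hp.left hp.right hν hQν hQ] with P₀ hP₀
    obtain ⟨⟨a₀, ha₀⟩, ⟨b₀, hb₀⟩, ⟨u₀, hu₀⟩⟩ := hP₀.exists_means hp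
    refine le_trans ?_ (mul_le_mul' le_rfl
      (hP₀.ofReal_le_priorMoment hp.left hp.right ha₀ hb₀ hu₀ (a := a) (b := b) (u := u)))
    rw [← ENNReal.ofReal_mul hε.le]
    set α : (Fin (n + 1) → ℝ) → ℝ := fun w =>
      ‖weightedSum w (a₀ - a) fun i => φ (z i) - a‖ ^ 2 with hα
    set β : (Fin (n + 1) → ℝ) → ℝ := fun w =>
      ‖weightedSum w (b₀ - b) fun i => ψ (z i) - b‖ ^ 2 with hβ
    set γ : (Fin (n + 1) → ℝ) → ℝ := fun w =>
      ‖weightedSum w (u₀ - u) fun i => tensorFeature φ ψ (z i) - u‖ ^ 2 with hγ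
    have cα : Continuous α := (continuous_weightedSum _ _).norm.pow 2
    have cβ : Continuous β := (continuous_weightedSum _ _).norm.pow 2
    have cγ : Continuous γ := (continuous_weightedSum _ _).norm.pow 2
    have hpt : ∀ᵐ w ∂dirichletLaw (weightParam s n),
        ‖hsic kX kY (mixture (fun i : Fin n => z i) w P₀) - X‖ₑ
          ≤ ENNReal.ofReal (t * X + L * (γ w + ‖b‖ ^ 2 * α w + ‖a‖ ^ 2 * β w + α w * β w)) := by
      -- Total mass one needs s + n > 0, hence n > 0 when s = 0.
      filter_upwards [ae_nonneg_dirichletLaw hw0, ae_sum_eq_one_dirichletLaw hw0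
        (by rw [sum_weightParam]; positivity)] with w hw hw1
      rw [hp.hsic_mixture hP₀ ha₀ hb₀ hu₀ z hw, Real.enorm_eq_ofReal_abs]
      refine ENNReal.ofReal_le_ofReal ?_
      have := abs_norm_covPart_sq_sub_le u (weightedSum w u₀ fun i => tensorFeature φ ψ (z i))
        a (weightedSum w a₀ fun i => φ (z i)) b (weightedSum w b₀ fun i => ψ (z i)) ht0
      rw [weightedSum_sub hw1, weightedSum_sub hw1, weightedSum_sub hw1] at this
      exact this
    have cF : Continuous fun w => t * X
        + L * (γ w + ‖b‖ ^ 2 * α w + ‖a‖ ^ 2 * β w + α w * β w) := by fun_prop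
    refine (lintegral_mono_ae hpt).trans ?_
    rw [← ofReal_integral_eq_lintegral_ofReal (integrable_dirichletLaw hw0 cF)
      (ae_of_all _ fun w => by positivity)]
    refine ENNReal.ofReal_le_ofReal ?_
    have e : ∫ w, (t * X + L * (γ w + ‖b‖ ^ 2 * α w + ‖a‖ ^ 2 * β w + α w * β w))
          ∂dirichletLaw (weightParam s n)
        = t * X + L * (∫ w, γ w ∂dirichletLaw (weightParam s n)
          + ‖b‖ ^ 2 * ∫ w, α w ∂dirichletLaw (weightParam s n)
          + ‖a‖ ^ 2 * ∫ w, β w ∂dirichletLaw (weightParam s n)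
          + ∫ w, α w * β w ∂dirichletLaw (weightParam s n)) := by
      rw [integral_add (integrable_const _) (integrable_dirichletLaw hw0 (by fun_prop)),
        integral_const_mul L, integral_add (integrable_dirichletLaw hw0 (by fun_prop))
          (integrable_dirichletLaw hw0 (by fun_prop)),
        integral_add (integrable_dirichletLaw hw0 (by fun_prop))
          (integrable_dirichletLaw hw0 (by fun_prop)),
        integral_add (integrable_dirichletLaw hw0 (by fun_prop))
          (integrable_dirichletLaw hw0 (by fun_prop)), integral_const_mul (‖b‖ ^ 2),
        integral_const_mul (‖a‖ ^ 2)]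
      simp
    rw [e]
    have i1 := h1 (a₀ - a)
    have i2 := h2 (b₀ - b)
    have i3 := h3 (u₀ - u)
    have i4 := h4 (a₀ - a) (b₀ - b)
    set p := 1 + ‖a₀ - a‖ ^ 2 with hpdef
    set q := 1 + ‖b₀ - b‖ ^ 2 with hqdef
    set r := 1 + ‖u₀ - u‖ ^ 2 with hrdef
    have hp1 : 1 ≤ p := by rw [hpdef]; linarith [sq_nonneg ‖a₀ - a‖]
    have hq1 : 1 ≤ q := by rw [hqdef]; linarith [sq_nonneg ‖b₀ - b‖]
    have hr1 : 1 ≤ r := by rw [hrdef]; linarith [sq_nonneg ‖u₀ - u‖]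
    have hpq : p ≤ p * q := le_mul_of_one_le_right (by linarith) hq1
    have hqp : q ≤ p * q := le_mul_of_one_le_left (by linarith) hp1
    calc _ ≤ t * X + L * (δ * r + ‖b‖ ^ 2 * (δ * p) + ‖a‖ ^ 2 * (δ * q) + δ * (p * q)) := by
          gcongr
      _ ≤ ε / 2 * (p * q + r) + L * (δ * r + ‖b‖ ^ 2 * (δ * (p * q)) + ‖a‖ ^ 2 * (δ * (p * q))
          + δ * (p * q)) := by
          refine add_le_add (htX.trans (le_mul_of_one_le_right (by positivity)
            (show 1 ≤ p * q + r by linarith))) ?_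
          gcongr
      _ ≤ ε / 2 * (p * q + r) + L * (δ * (1 + ‖a‖ ^ 2 + ‖b‖ ^ 2)) * (p * q + r) := by
          have h5 : 0 ≤ L * (δ * ((‖a‖ ^ 2 + ‖b‖ ^ 2) * r)) := by positivity
          linarith
      _ = ε * (p * q + r) := by rw [hδL]; ring
  rw [ENNReal.tendsto_nhds_zero]
  intro ε hε
  rcases eq_or_ne ε ⊤ with rfl | hεt
  · exact Eventually.of_forall fun n => le_top
  have hε' : 0 < ε.toReal := ENNReal.toReal_pos hε.ne' hεt
  filter_upwards [key (ε.toReal / (T.toReal + 1)) (by positivity)] with n hn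
  refine hn.trans ?_
  rw [← ENNReal.ofReal_toReal hfin, ← ENNReal.ofReal_mul (by positivity),
    ← ENNReal.ofReal_toReal hεt]
  refine ENNReal.ofReal_le_ofReal ?_
  rw [ENNReal.toReal_ofReal ENNReal.toReal_nonneg, ENNReal.toReal_ofReal ENNReal.toReal_nonneg,
    div_mul_eq_mul_div, div_le_iff₀ (by positivity)]
  nlinarith

/-- The sample enters the limit statements only through this property, for `φ`, `ψ` and their tensor
product; the rest is deterministic in ω. -/
theorem ae_isCentered {S H Ω : Type*} [MeasurableSpace S] [NormedAddCommGroup H]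
    [InnerProductSpace ℝ H] [CompleteSpace H] [MeasurableSpace Ω] {μ : Measure Ω}
    [IsProbabilityMeasure μ] {P : Measure S} [IsProbabilityMeasure P] {Z : ℕ → Ω → S}
    (hlaw : ∀ i, HasLaw (Z i) P μ) (hindep : iIndepFun Z μ) {χ : S → H} (hχ : IsFeature χ)
    (hχP : Integrable (fun z => ‖χ z‖) P) {m : H} (hm : HasMean χ P m) :
    ∀ᵐ ω ∂μ, IsCentered fun i => χ (Z i ω) - m := by
  have hn := (hχ.sub_const m).measurable_norm
  have hi : Integrable (fun z => ‖χ z - m‖) P :=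
    (hχP.add (integrable_const ‖m‖)).mono' hn.aestronglyMeasurable
      (ae_of_all _ fun z => by simpa using norm_sub_le (χ z) m)
  filter_upwards [ae_tendsto_norm_average hlaw hindep hχ hχP hm,
    ae_tailSmall hlaw hindep hn (fun z => norm_nonneg _) hi] with ω h1 h2
  exact ⟨h1, h2⟩

end Posterior

/-! ### From L¹ convergence to means and probabilities -/

theorem tendsto_integral_of_tendsto_lintegral_enorm_sub {S : Type*} [MeasurableSpace S]
    {ρ : ℕ → Measure S} [∀ n, IsProbabilityMeasure (ρ n)] {h : S → ℝ} {c : ℝ}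
    (hint : ∀ n, Integrable h (ρ n))
    (hL1 : Tendsto (fun n => ∫⁻ M, ‖h M - c‖ₑ ∂ρ n) atTop (𝓝 0)) :
    Tendsto (fun n => ∫ M, h M ∂ρ n) atTop (𝓝 c) := by
  rw [tendsto_iff_edist_tendsto_0]
  refine tendsto_of_tendsto_of_tendsto_of_le_of_le tendsto_const_nhds hL1
    (fun n => zero_le) fun n => ?_
  have e : ∫ M, h M ∂ρ n - c = ∫ M, (h M - c) ∂ρ n := by
    rw [integral_sub (hint n) (integrable_const _)]
    simp
  simp only [edist_eq_enorm_sub, e]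
  exact enorm_integral_le_lintegral_enorm _

theorem tendsto_measure_of_tendsto_lintegral_enorm_sub {S : Type*} [MeasurableSpace S]
    {ρ : ℕ → Measure S} [∀ n, IsProbabilityMeasure (ρ n)] {h : S → ℝ} {c : ℝ}
    (hint : ∀ n, Integrable h (ρ n))
    (hL1 : Tendsto (fun n => ∫⁻ M, ‖h M - c‖ₑ ∂ρ n) atTop (𝓝 0)) {ε : ℝ} (hε : 0 < ε) :
    Tendsto (fun n => ρ n {M | ε ≤ |h M - c|}) atTop (𝓝 0) := by
  have hε' : ENNReal.ofReal ε ≠ 0 := by simpa using hε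
  have h0 := ENNReal.Tendsto.div_const hL1 (Or.inr hε')
  rw [ENNReal.zero_div] at h0
  refine tendsto_of_tendsto_of_tendsto_of_le_of_le tendsto_const_nhds h0
    (fun n => zero_le) fun n => ?_
  refine le_trans (measure_mono ?_) (meas_ge_le_lintegral_div
    ((hint n).sub (integrable_const c)).aestronglyMeasurable.enorm hε' ENNReal.ofReal_ne_top)
  intro M hM
  simp only [Set.mem_ofPred_eq] at hM ⊢
  rw [Pi.sub_apply, Real.enorm_eq_ofReal_abs]
  exact ENNReal.ofReal_le_ofReal hM

end BayesHSIC

end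

/-! ### Posterior and empirical limits of HSIC -/

open BayesHSIC in
theorem mainTheorem2 {Ω 𝒳 𝒴 : Type*} [MeasurableSpace Ω] [MeasurableSpace 𝒳] [MeasurableSpace 𝒴]
    -- kernels on the two domains
    (kX : 𝒳 → 𝒳 → ℝ) (kY : 𝒴 → 𝒴 → ℝ)
    (hkX : BayesHSIC.IsMeasurableKernel kX) (hkY : BayesHSIC.IsMeasurableKernel kY)
    -- an i.i.d. sample from `P`, whose kernel mean embeddings exist
    (μ : Measure Ω) [IsProbabilityMeasure μ]
    (P : Measure (𝒳 × 𝒴)) [IsProbabilityMeasure P]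
    (Z : ℕ → Ω → 𝒳 × 𝒴) (hlaw : ∀ i, HasLaw (Z i) P μ) (hindep : iIndepFun Z μ)
    (hPX : Integrable (fun z : 𝒳 × 𝒴 => √(kX z.1 z.1)) P)
    (hPY : Integrable (fun z : 𝒳 × 𝒴 => √(kY z.2 z.2)) P)
    (hPXY : Integrable (fun z : 𝒳 × 𝒴 => √(kX z.1 z.1 * kY z.2 z.2)) P)
    -- the prior `Dp(s, ν)`; the limiting case `s = 0` (no prior component) is included
    (s : ℝ) (hs : 0 ≤ s) (ν : Measure (𝒳 × 𝒴)) [IsProbabilityMeasure ν]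
    (hνX : Integrable (fun z : 𝒳 × 𝒴 => kX z.1 z.1) ν)
    (hνY : Integrable (fun z : 𝒳 × 𝒴 => kY z.2 z.2) ν)
    (hνXY : Integrable (fun z : 𝒳 × 𝒴 => kX z.1 z.1 * kY z.2 z.2) ν)
    (Q : Measure (Measure (𝒳 × 𝒴))) [IsProbabilityMeasure Q]
    (hQ : 0 < s → BayesHSIC.IsDirichletProcess (ENNReal.ofReal s • ν) Q) :
    ∀ᵐ ω ∂μ,
      -- the posterior mean exists for every sample size
      (∀ n : ℕ, Integrable (BayesHSIC.hsic kX kY)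
        (BayesHSIC.posterior s Q fun i : Fin n => Z i ω)) ∧
      -- the classical empirical estimate converges to the population value
      Tendsto (fun n : ℕ => BayesHSIC.hsicObs kX kY fun i : Fin n => Z i ω)
        atTop (𝓝 (BayesHSIC.hsic kX kY P)) ∧
      -- the posterior mean converges to the same limit
      Tendsto (fun n : ℕ => ∫ M, BayesHSIC.hsic kX kY M
          ∂(BayesHSIC.posterior s Q fun i : Fin n => Z i ω))
        atTop (𝓝 (BayesHSIC.hsic kX kY P)) ∧
      -- consistency: the posterior of the criterion concentrates at the population value
      ∀ ε : ℝ, 0 < ε →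
        Tendsto (fun n : ℕ => BayesHSIC.posterior s Q (fun i : Fin n => Z i ω)
            {M | ε ≤ |BayesHSIC.hsic kX kY M - BayesHSIC.hsic kX kY P|})
          atTop (𝓝 0) := by
  classical
  -- in the limiting case the prior component may be replaced by a deterministic one
  obtain ⟨Q', hQ'prob, hQ'ae, hQ'bound, hpost⟩ : ∃ Q' : Measure (Measure (𝒳 × 𝒴)),
      IsProbabilityMeasure Q' ∧ (∀ᵐ M ∂Q', IsProbabilityMeasure M) ∧ SecondMomentBound ν Q' ∧
        ∀ (n : ℕ) (z : Fin n → 𝒳 × 𝒴), posterior s Q z = posterior s Q' z := by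
    rcases hs.eq_or_lt with rfl | hs'
    · refine ⟨Measure.dirac ν, inferInstance, ?_, secondMomentBound_dirac ν,
        fun n z => posterior_zero_eq _ _ z⟩
      have h1 : ∀ᵐ M ∂Measure.dirac ν, M Set.univ = 1 := by
        rw [ae_dirac_iff (measurableSet_eq_fun (Measure.measurable_coe MeasurableSet.univ)
          measurable_const)]
        exact measure_univ
      filter_upwards [h1] with M hM using ⟨hM⟩
    · exact ⟨Q, inferInstance, (hQ hs').ae_isProbabilityMeasure,
        (hQ hs').secondMomentBound hs', fun n z => rfl⟩
  obtain ⟨H, _, _, _, φ₀, hφ₀, hφk⟩ := hkX.exists_feature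
  obtain ⟨H', _, _, _, ψ₀, hψ₀, hψk⟩ := hkY.exists_feature
  obtain ⟨φ, ψ, hp⟩ : ∃ (φ : 𝒳 × 𝒴 → H) (ψ : 𝒳 × 𝒴 → H'), IsFeaturePair kX kY φ ψ :=
    ⟨φ₀ ∘ Prod.fst, ψ₀ ∘ Prod.snd, hφ₀.comp measurable_fst, hψ₀.comp measurable_snd,
      fun z z' => hφk _ _, fun z z' => hψk _ _⟩
  have hΦ := hp.left.tensor hp.right
  have sqX : ∀ z, ‖φ z‖ ^ 2 = kX z.1 z.1 := fun z => by
    rw [← real_inner_self_eq_norm_sq, hp.inner_left]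
  have sqY : ∀ z, ‖ψ z‖ ^ 2 = kY z.2 z.2 := fun z => by
    rw [← real_inner_self_eq_norm_sq, hp.inner_right]
  have nX : ∀ z, ‖φ z‖ = √(kX z.1 z.1) := fun z => by
    rw [← sqX, Real.sqrt_sq (norm_nonneg _)]
  have nY : ∀ z, ‖ψ z‖ = √(kY z.2 z.2) := fun z => by
    rw [← sqY, Real.sqrt_sq (norm_nonneg _)]
  have nXY : ∀ z, ‖tensorFeature φ ψ z‖ = √(kX z.1 z.1 * kY z.2 z.2) := fun z => by
    rw [norm_tensorFeature, ← sqX, ← sqY, ← mul_pow, Real.sqrt_sq (by positivity)]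
  have hν : HasSecondMoments φ ψ ν :=
    ⟨inferInstance, by simpa only [sqX] using hνX, by simpa only [sqY] using hνY,
      by simpa only [norm_tensorFeature, mul_pow, sqX, sqY] using hνXY⟩
  have iX : Integrable (fun z => ‖φ z‖) P := by simpa only [nX] using hPX
  have iY : Integrable (fun z => ‖ψ z‖) P := by simpa only [nY] using hPY
  have iXY : Integrable (fun z => ‖tensorFeature φ ψ z‖) P := by simpa only [nXY] using hPXY
  obtain ⟨a, ha⟩ := hp.left.exists_hasMean iX
  obtain ⟨b, hb⟩ := hp.right.exists_hasMean iY
  obtain ⟨u, hu⟩ := hΦ.exists_hasMean iXY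
  have hlim : hsic kX kY P = ‖covPart u a b‖ ^ 2 :=
    hsic_eq_norm_sq hp.left hp.right hp.inner_left hp.inner_right iX iY
      (by simpa only [norm_tensorFeature] using iXY) ha hb hu
  filter_upwards [ae_isCentered hlaw hindep hp.left iX ha,
    ae_isCentered hlaw hindep hp.right iY hb, ae_isCentered hlaw hindep hΦ iXY hu]
    with ω ca cb cu
  have hint : ∀ n : ℕ, Integrable (hsic kX kY) (posterior s Q fun i : Fin n => Z i ω) :=
    fun n => by
      rw [hpost]
      exact hp.integrable_hsic_posterior hkX.measurable hkY.measurable hs hν hQ'bound hQ'ae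
        (fun i => Z i ω) n
  have hL1 : Tendsto (fun n : ℕ => ∫⁻ M, ‖hsic kX kY M - hsic kX kY P‖ₑ
      ∂(posterior s Q fun i : Fin n => Z i ω)) atTop (𝓝 0) := by
    rw [hlim]
    simp_rw [hpost]
    exact hp.tendsto_lintegral_posterior hkX.measurable hkY.measurable hs hν hQ'bound hQ'ae
      (z := fun i => Z i ω) ca cb cu
  have hprob (n : ℕ) : IsProbabilityMeasure (posterior s Q fun i : Fin n => Z i ω) :=
    isProbabilityMeasure_posterior hs Q _
  refine ⟨hint, ?_, tendsto_integral_of_tendsto_lintegral_enorm_sub hint hL1,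
    fun ε hε => tendsto_measure_of_tendsto_lintegral_enorm_sub hint hL1 hε⟩
  rw [hlim]
  exact hp.tendsto_hsicObs (z := fun i => Z i ω) ca cb cu
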